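/- **Setting.** A seller sells $k$ items in $k$ stages to one buyer. The buyer's value $v_i\in[\underline v_i,\bar v_i]$ for item $i$, with $0\le\underline v_i$, is drawn independently of the other values from a known distribution $F_i$ on $[\underline v_i,\bar v_i]$ (not necessarily with a density) whose smallest possible value is $\underline v_i$, i.e. $\Pr[v_i<t]>0$ for all $t>\underline v_i$; it is revealed to the buyer at the start of stage $i$. A mechanism consists of (measurable) allocation probabilities $x_i(v_{\le i})\in[0,1]$ and payments $p_i(v_{\le i})\in\mathbb R$, $i=1,\dots,k$, for which the expected payments exist, ex ante and after every history. With $U_i(v_{\le i})=\mathbb E_{v_{i+1},\dots,v_k}\big[\sum_{j>i}\big(v_jx_j(v_{\le j})-p_j(v_{\le j})\big)\big]$, it is *feasible* if it is periodic incentive compatible, $$v_ix_i(v_{\le i})-p_i(v_{\le i})+U_i(v_{\le i})\ \ge\ v_ix_i(v_{<i},v_i')-p_i(v_{<i},v_i')+U_i(v_{<i},v_i')\quad\text{for all } i,\ v_{\le i},\ v_i',$$ and ex-post individually rational, $v_ix_i(v_{\le i})-p_i(v_{\le i})\ge0$ for all $i$, $v_{\le i}$. Its revenue is $\mathbb E[\sum_i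 p_i(v_{\le i})]$. **Pre-processing.** Let $\hat h_{k+1}(c)=0$ for $c\ge0$ and $\hat h_{k+1}(c)=-\infty$ for $c<0$, and for $i=k,\dots,1$ and $c\in\mathbb R$ let $$\hat h_i(c)=\max_{0\le Y\le1}\ \mathbb E\big[\hat h_{i+1}\big(Y(v_i-\mathbb E v_i)+c\big)\big]+Y\,\mathbb E v_i .$$ Let $Y_i^c\in[0,1]$ be an optimizer, chosen measurably in $c$, and let $c_0$ be a maximizer of $\hat h_1(c)-c$. **Mechanism 1.** At each stage $i$, ignore the history and post a monopoly price for item $i$, i.e. a price $r$ maximizing $r\Pr[v_i\ge r]$; the buyer buys if and only if $v_i\ge r$. **Mechanism 2.** At each stage $i$, the buyer reports $v_i$ and is allocated the item with probability $Y_i^{c_{i-1}}$. He pays $v_iY_i^{c_{i-1}}$ if $i<k$, and $Y_i^{c_{i-1}}\mathbb E v_i-c_{i-1}$ if $i=k$. The state is then updated to $c_i=Y_i^{c_{i-1}}(v_i-\mathbb E v_i)+c_{i-1}$. **Theorem 3.3.** The functions $\hat h_1,\dots,\hat h_{k+1}$ are concave, and the monopoly prices, the measurable optimizers $Y_i^c$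 and the maximizer $c_0$ exist. For every choice of them, Mechanism 1, Mechanism 2 and the mechanism that runs each of the two with probability $1/2$ are feasible, and the latter's revenue, which is the average of the revenues of Mechanisms 1 and 2, is at least half of the revenue of every feasible mechanism. -/

import Mathlib

open MeasureTheory Set
open scoped ENNReal

noncomputable section

namespace DynamicSale

/-- A direct mechanism selling `k` items in `k` stages (stage `i : Fin k`).  `alloc i v` and `pay i v`
are the allocation probability and the payment at stage `i` when the sequence of reports is `v`. -/
structure Mechanism (k : ℕ) where
  alloc : Fin k → (Fin k → ℝ) → ℝ
  pay : Fin k → (Fin k → ℝ) → ℝ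

/-- The value sequence that follows `v` up to and including stage `i`, and `w` afterwards. -/
def splice {k : ℕ} (i : Fin k) (v w : Fin k → ℝ) : Fin k → ℝ :=
  fun j => if j ≤ i then v j else w j

namespace Mechanism

variable {k : ℕ}

/-- The truthful buyer's utility at stage `i`. -/
def stageUtility (M : Mechanism k) (i : Fin k) (v : Fin k → ℝ) : ℝ :=
  v i * M.alloc i v - M.pay i v

/-- Expected utility from the stages after `i`, given the reports `v` up to stage `i`, with values
drawn independently and reported truthfully from stage `i + 1` on.  The coordinates of `w` up to
stage `i` are ignored by the integrand. -/
def futureUtility (M : Mechanism k) (μ : Fin k → Measure ℝ) (i : Fin k) (v : Fin k → ℝ) : ℝ :=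
  ∫ w, ∑ j ∈ Finset.Ioi i, M.stageUtility j (splice i v w) ∂(Measure.pi μ)

/-- Expected total payment under truthful reporting. -/
def revenue (M : Mechanism k) (μ : Fin k → Measure ℝ) : ℝ :=
  ∫ v, ∑ i, M.pay i v ∂(Measure.pi μ)

/-- Feasible mechanisms, when the value of item `i` ranges over `[a i, b i]` and has law `μ i`
(`Set.Icc a b` is the box of all value sequences). -/
structure Feasible (M : Mechanism k) (μ : Fin k → Measure ℝ) (a b : Fin k → ℝ) : Prop where
  measurable_alloc : ∀ i, Measurable (M.alloc i)
  measurable_pay : ∀ i, Measurable (M.pay i)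
  /-- The outcome at stage `i` depends on the reports up to stage `i` only. -/
  adapted : ∀ i v w, (∀ j ≤ i, v j = w j) → M.alloc i v = M.alloc i w ∧ M.pay i v = M.pay i w
  alloc_mem : ∀ i, ∀ v ∈ Icc a b, M.alloc i v ∈ Icc (0 : ℝ) 1
  /-- Expected payments exist, ex ante and after every history. -/
  integrable_pay : ∀ i, Integrable (M.pay i) (Measure.pi μ)
  integrable_pay_splice : ∀ i, ∀ v ∈ Icc a b, ∀ j, i < j →
    Integrable (fun w => M.pay j (splice i v w)) (Measure.pi μ)
  /-- Periodic incentive compatibility. -/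
  pic : ∀ i, ∀ v ∈ Icc a b, ∀ v' ∈ Icc (a i) (b i),
    v i * M.alloc i (Function.update v i v') - M.pay i (Function.update v i v')
        + M.futureUtility μ i (Function.update v i v')
      ≤ v i * M.alloc i v - M.pay i v + M.futureUtility μ i v
  /-- Ex-post individual rationality at every stage. -/
  ir : ∀ i, ∀ v ∈ Icc a b, 0 ≤ M.stageUtility i v

/-- The mechanism that runs `M` or `N`, each with probability one half. -/
def coinFlip (M N : Mechanism k) : Mechanism k where
  alloc i v := (1 / 2) * M.alloc i v + (1 / 2) * N.alloc i v
  pay i v := (1 / 2) * M.pay i v + (1 / 2) * N.pay i v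

end Mechanism

/-- `r` is an optimal monopoly price for a buyer with value distribution `μ`. -/
def IsMonopolyPrice (μ : Measure ℝ) (r : ℝ) : Prop :=
  ∀ s : ℝ, s * μ.real (Ici s) ≤ r * μ.real (Ici r)

/-- At each stage `i`, ignore the history and post the price `r i`. -/
def postedPrices {k : ℕ} (r : Fin k → ℝ) : Mechanism k where
  alloc i v := if r i ≤ v i then 1 else 0
  pay i v := if r i ≤ v i then r i else 0

/-- Expectation of an extended-real function: that of the positive part minus that of the negative
part.  It is used for functions that are bounded above but may take the value `-∞`. -/
def extExpectation (μ : Measure ℝ) (g : ℝ → EReal) : EReal :=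
  ((∫⁻ v, (g v).toENNReal ∂μ : ℝ≥0∞) : EReal) - ((∫⁻ v, (-(g v)).toENNReal ∂μ : ℝ≥0∞) : EReal)

/-- The mean of a value distribution. -/
def mean (μ : Measure ℝ) : ℝ := ∫ v, v ∂μ

/-- The objective `E[h (y (v - E v) + c)] + y E v` of the one-stage problem at state `c`,
with tradeoff function `h`, as a function of the allocation probability `y`. -/
def stageObjective (μ : Measure ℝ) (h : ℝ → EReal) (c y : ℝ) : EReal :=
  extExpectation μ (fun v => h (y * (v - mean μ) + c)) + ((y * mean μ : ℝ) : EReal)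

/-- The tradeoff functions, by backward recursion.  `tradeoff μ (Fin.last k)` is the terminal one
(`0` on `c ≥ 0`, `-∞` on `c < 0`); the one of stage `i` is `tradeoff μ i.castSucc`, and it is obtained
from `tradeoff μ i.succ` by maximizing the stage objective over `0 ≤ y ≤ 1`. -/
def tradeoff {k : ℕ} (μ : Fin k → Measure ℝ) : Fin (k + 1) → ℝ → EReal :=
  Fin.reverseInduction (motive := fun _ => ℝ → EReal)
    (fun c => if 0 ≤ c then 0 else ⊥)
    (fun i h c => ⨆ y ∈ Icc (0 : ℝ) 1, stageObjective (μ i) h c y)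

theorem tradeoff_last {k : ℕ} (μ : Fin k → Measure ℝ) (c : ℝ) :
    tradeoff μ (Fin.last k) c = if 0 ≤ c then 0 else ⊥ := by
  simp [tradeoff]

theorem tradeoff_castSucc {k : ℕ} (μ : Fin k → Measure ℝ) (i : Fin k) (c : ℝ) :
    tradeoff μ i.castSucc c
      = ⨆ y ∈ Icc (0 : ℝ) 1, stageObjective (μ i) (tradeoff μ i.succ) c y := by
  simp [tradeoff]

/-- `Y i c` is, for every stage `i` and state `c`, an optimizer of the stage problem. -/
def IsOptimalAllocation {k : ℕ} (μ : Fin k → Measure ℝ) (Y : Fin k → ℝ → ℝ) : Prop :=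
  ∀ i c, Y i c ∈ Icc (0 : ℝ) 1 ∧ ∀ y ∈ Icc (0 : ℝ) 1,
    stageObjective (μ i) (tradeoff μ i.succ) c y ≤ stageObjective (μ i) (tradeoff μ i.succ) c (Y i c)

/-- `c₀` maximizes `c ↦ ĥ c - c`, where `ĥ` is the tradeoff function of the first stage. -/
def IsOptimalInitialState {k : ℕ} (μ : Fin k → Measure ℝ) (c₀ : ℝ) : Prop :=
  ∀ c : ℝ, tradeoff μ 0 c - (c : EReal) ≤ tradeoff μ 0 c₀ - (c₀ : EReal)

/-- The scalar state: `state μ Y c₀ v i.castSucc` is the state entering stage `i` and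
`state μ Y c₀ v i.succ` the one leaving it; it starts at `c₀`. -/
def state {k : ℕ} (μ : Fin k → Measure ℝ) (Y : Fin k → ℝ → ℝ) (c₀ : ℝ) (v : Fin k → ℝ) :
    Fin (k + 1) → ℝ :=
  Fin.induction (motive := fun _ => ℝ) c₀ (fun i c => Y i c * (v i - mean (μ i)) + c)

theorem state_zero {k : ℕ} (μ : Fin k → Measure ℝ) (Y : Fin k → ℝ → ℝ) (c₀ : ℝ)
    (v : Fin k → ℝ) : state μ Y c₀ v 0 = c₀ := by
  simp [state]

theorem state_succ {k : ℕ} (μ : Fin k → Measure ℝ) (Y : Fin k → ℝ → ℝ) (c₀ : ℝ)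
    (v : Fin k → ℝ) (i : Fin k) :
    state μ Y c₀ v i.succ
      = Y i (state μ Y c₀ v i.castSucc) * (v i - mean (μ i)) + state μ Y c₀ v i.castSucc := by
  simp [state]

/-- The state-based mechanism: with `c` the state entering stage `i`, allocate with probability
`Y i c`, charge `v i * Y i c` before the last stage and `Y i c * E v_i - c` at the last stage. -/
def stateMechanism {k : ℕ} (μ : Fin k → Measure ℝ) (Y : Fin k → ℝ → ℝ) (c₀ : ℝ) :
    Mechanism k where
  alloc i v := Y i (state μ Y c₀ v i.castSucc)
  pay i v :=
    if (i : ℕ) + 1 < k then v i * Y i (state μ Y c₀ v i.castSucc)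
    else Y i (state μ Y c₀ v i.castSucc) * mean (μ i) - state μ Y c₀ v i.castSucc

end DynamicSale

end

/-!
The revenue of a feasible mechanism is its welfare minus the buyer's utility. The proof bounds the
welfare that remains after a history by the utility that remains, by backward induction: if `U` is
the utility to go before stage `i`, then the welfare to go is at most the tradeoff function at `U`
plus the monopoly revenues of the items from `i` on
(`Mechanism.Feasible.rewardToGo_stageWelfare_le`).

The inductive step is the one-item comparison `exists_constant_allocation`. Given the history, let
`W t` be the utility to go of type `t`. Incentive compatibility makes `W` convex with the
allocation probability as subgradient; individual rationality makes it nonnegative and an upper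
bound on the utility promised for later stages. Replace `W` by the line that has the same value at
the lowest type and the same mean, and whose slope is therefore a constant allocation probability.
First, the convex function crosses this line once, so it is riskier and the concave tradeoff
function prefers the line (`integral_concave_le_of_single_crossing`). Secondly, the welfare
exceeds that of the constant allocation by at most the revenue of the static mechanism with
utility curve `W - W a`, hence by at most a monopoly revenue. The latter is the optimality of
posted prices for an arbitrary law (`integral_payment_le`), proved by comparing payments with
mixtures of posted prices on finer and finer grids.

The state-based mechanism attains the tradeoff bound: its state is the buyer's utility to go, a
martingale, and its welfare to go is the tradeoff function at the state. As the initial state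
maximizes the difference of the tradeoff function and the state, no feasible mechanism earns more
than the two mechanisms together.

The tradeoff functions are real and concave on the nonnegative states and `-∞` elsewhere. Besides
concavity, the recursion preserves a linear bound at `0` (`exists_shape_step`), which gives
continuity up to the boundary and hence the existence of optimizers. A state is feasible for an
allocation probability exactly when the lowest type leads to a nonnegative next state, and so the
states remain nonnegative on the whole box of values and not only almost surely.
-/

namespace DynamicSale

open Filter Topology

/-! ### Resampling one coordinate of a product measure -/

/-- Redrawing one coordinate of a sample from a product measure gives a sample from the same
measure. -/
theorem measurePreserving_update {ι : Type*} [Fintype ι] [DecidableEq ι] (μ : ι → Measure ℝ)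
    [∀ i, IsProbabilityMeasure (μ i)] (i : ι) :
    MeasurePreserving (fun p : ℝ × (ι → ℝ) => Function.update p.2 i p.1)
      ((μ i).prod (Measure.pi μ)) (Measure.pi μ) := by
  have hm : Measurable (fun p : ℝ × (ι → ℝ) => Function.update p.2 i p.1) := by
    refine measurable_pi_iff.2 fun j => ?_
    by_cases h : j = i
    · subst h
      simpa using measurable_fst
    · simpa [Function.update_of_ne h, Function.comp_def] using
        (measurable_pi_apply (X := fun _ : ι => ℝ) j).comp (measurable_snd (α := ℝ))
  refine ⟨hm, (Measure.pi_eq fun s hs => ?_).symm⟩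
  have hpre : (fun p : ℝ × (ι → ℝ) => Function.update p.2 i p.1) ⁻¹' (univ.pi s)
      = s i ×ˢ univ.pi (Function.update s i univ) := by
    ext p
    simp only [mem_preimage, Set.mem_pi, mem_univ, true_implies, mem_prod]
    constructor
    · intro h
      refine ⟨by simpa using h i, fun j => ?_⟩
      by_cases hj : j = i
      · subst hj
        simp
      · simpa [Function.update_of_ne hj] using h j
    · rintro ⟨h1, h2⟩ j
      by_cases hj : j = i
      · subst hj
        simpa using h1
      · simpa [Function.update_of_ne hj] using h2 j
  rw [Measure.map_apply hm (MeasurableSet.univ_pi hs), hpre, Measure.prod_prod, Measure.pi_pi,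
    ← Finset.mul_prod_erase _ _ (Finset.mem_univ i),
    ← Finset.mul_prod_erase _ (fun j => μ j (s j)) (Finset.mem_univ i)]
  simp only [Function.update_self, measure_univ, one_mul]
  congr 1
  refine Finset.prod_congr rfl fun j hj => ?_
  rw [Function.update_of_ne (Finset.ne_of_mem_erase hj)]

/-! ### Expected rewards to go -/

section RewardToGo

variable {k : ℕ}

/-- The value sequence that follows `v` before stage `n` and `w` from stage `n` on.  The index
`n : Fin (k + 1)` also allows the empty and the full history. -/
def prepend (n : Fin (k + 1)) (v w : Fin k → ℝ) : Fin k → ℝ :=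
  fun j => if j.castSucc < n then v j else w j

theorem splice_eq_prepend (i : Fin k) (v w : Fin k → ℝ) :
    splice i v w = prepend i.succ v w := by
  funext j
  simp [splice, prepend, Fin.castSucc_lt_succ_iff]

theorem prepend_zero (v w : Fin k → ℝ) : prepend 0 v w = w := by
  funext j
  simp [prepend]

theorem prepend_castSucc_update (i : Fin k) (v w : Fin k → ℝ) (t : ℝ) :
    prepend i.castSucc v (Function.update w i t) = prepend i.succ (Function.update v i t) w := by
  funext j
  rcases lt_trichotomy j i with h | h | h
  · have h1 : j.castSucc < i.castSucc := h
    have h2 : j.castSucc < i.succ := Fin.castSucc_lt_succ_iff.2 h.le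
    simp [prepend, h2, h, h.ne]
  · subst h
    simp [prepend, Fin.castSucc_lt_succ_iff]
  · have h1 : ¬ j.castSucc < i.castSucc := not_lt.2 h.le
    have h2 : ¬ j.castSucc < i.succ := fun h3 => (not_le.2 h) (Fin.castSucc_lt_succ_iff.1 h3)
    simp [prepend, h1, h2, h.ne']

theorem prepend_mem_Icc {a b v w : Fin k → ℝ} (n : Fin (k + 1)) (hv : v ∈ Icc a b)
    (hw : w ∈ Icc a b) : prepend n v w ∈ Icc a b := by
  refine ⟨fun j => ?_, fun j => ?_⟩ <;> by_cases h : j.castSucc < n <;> simp only [prepend, h] <;>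
    first
      | exact hv.1 j
      | exact hv.2 j
      | exact hw.1 j
      | exact hw.2 j

theorem update_mem_Icc {a b v : Fin k → ℝ} (hv : v ∈ Icc a b) {i : Fin k} {t : ℝ}
    (ht : t ∈ Icc (a i) (b i)) : Function.update v i t ∈ Icc a b := by
  refine ⟨fun j => ?_, fun j => ?_⟩ <;> by_cases h : j = i
  · subst h; simpa using ht.1
  · simpa [h] using hv.1 j
  · subst h; simpa using ht.2
  · simpa [h] using hv.2 j

theorem measurable_prepend (n : Fin (k + 1)) (v : Fin k → ℝ) :
    Measurable (fun w => prepend n v w) := by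
  refine measurable_pi_iff.2 fun j => ?_
  by_cases h : j.castSucc < n
  · simp [prepend, h]
  · simpa [prepend, h] using measurable_pi_apply j

/-- The stages from `n` on. -/
def stagesFrom (n : Fin (k + 1)) : Finset (Fin k) := Finset.univ.filter fun j => n ≤ j.castSucc

theorem mem_stagesFrom {n : Fin (k + 1)} {j : Fin k} : j ∈ stagesFrom n ↔ n ≤ j.castSucc := by
  simp [stagesFrom]

theorem stagesFrom_last : stagesFrom (Fin.last k) = ∅ := by
  ext j
  simp [mem_stagesFrom]

theorem stagesFrom_zero : stagesFrom (0 : Fin (k + 1)) = Finset.univ := by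
  ext j
  simp [mem_stagesFrom]

theorem stagesFrom_succ (i : Fin k) : stagesFrom i.succ = Finset.Ioi i := by
  ext j
  simp [mem_stagesFrom, Fin.succ_le_castSucc_iff]

theorem sum_stagesFrom_castSucc (i : Fin k) (f : Fin k → ℝ) :
    ∑ j ∈ stagesFrom i.castSucc, f j = f i + ∑ j ∈ stagesFrom i.succ, f j := by
  have h : stagesFrom i.castSucc = insert i (stagesFrom i.succ) := by
    ext j
    simp only [mem_stagesFrom, Finset.mem_insert, Fin.succ_le_castSucc_iff,
      Fin.castSucc_le_castSucc_iff]
    exact ⟨fun h => h.eq_or_lt.imp Eq.symm id, fun h => h.elim (fun h => h.ge) le_of_lt⟩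
  rw [h, Finset.sum_insert (by simp [mem_stagesFrom, Fin.succ_le_castSucc_iff])]

/-- The expected sum of the rewards `f j v` of the stages `j` from `n` on, given the values `v`
before stage `n`. -/
noncomputable def rewardToGo (μ : Fin k → Measure ℝ) (f : Fin k → (Fin k → ℝ) → ℝ) (n : Fin (k + 1))
    (v : Fin k → ℝ) : ℝ :=
  ∫ w, ∑ j ∈ stagesFrom n, f j (prepend n v w) ∂(Measure.pi μ)

theorem rewardToGo_last (μ : Fin k → Measure ℝ) (f : Fin k → (Fin k → ℝ) → ℝ) (v : Fin k → ℝ) :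
    rewardToGo μ f (Fin.last k) v = 0 := by
  simp [rewardToGo, stagesFrom_last]

theorem Mechanism.futureUtility_eq_rewardToGo (M : Mechanism k) (μ : Fin k → Measure ℝ)
    (i : Fin k) (v : Fin k → ℝ) :
    M.futureUtility μ i v = rewardToGo μ M.stageUtility i.succ v := by
  simp [Mechanism.futureUtility, rewardToGo, stagesFrom_succ, splice_eq_prepend]

variable (μ : Fin k → Measure ℝ) [∀ i, IsProbabilityMeasure (μ i)]

/-- Dynamic programming: the reward to go is the expectation of the reward of the current stage plus
the reward to go after it. -/
theorem rewardToGo_castSucc {f : Fin k → (Fin k → ℝ) → ℝ} {i : Fin k} {v : Fin k → ℝ}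
    (hf : ∀ v w : Fin k → ℝ, (∀ j ≤ i, v j = w j) → f i v = f i w)
    (hint : ∀ j, i ≤ j → Integrable (fun w => f j (prepend i.castSucc v w)) (Measure.pi μ)) :
    Integrable (fun t => f i (Function.update v i t)
      + rewardToGo μ f i.succ (Function.update v i t)) (μ i) ∧
    rewardToGo μ f i.castSucc v = ∫ t, (f i (Function.update v i t)
      + rewardToGo μ f i.succ (Function.update v i t)) ∂(μ i) := by
  have hmp := measurePreserving_update μ i
  have hconst : ∀ t w, f i (prepend i.succ (Function.update v i t) w)
      = f i (Function.update v i t) := fun t w => hf _ _ fun j hj => by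
    simp [prepend, Fin.castSucc_lt_succ_iff, hj]
  set Φ : (Fin k → ℝ) → ℝ := fun w => ∑ j ∈ stagesFrom i.castSucc, f j (prepend i.castSucc v w)
    with hΦ
  set g : Fin k → ℝ × (Fin k → ℝ) → ℝ :=
    fun j p => f j (prepend i.succ (Function.update v i p.1) p.2) with hg
  have hgint : ∀ j, i ≤ j → Integrable (g j) ((μ i).prod (Measure.pi μ)) := fun j hj => by
    have := hmp.integrable_comp_of_integrable (hint j hj)
    simpa only [Function.comp_def, prepend_castSucc_update] using this
  have hsum : Integrable (fun p => ∑ j ∈ stagesFrom i.succ, g j p)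
      ((μ i).prod (Measure.pi μ)) := by
    refine integrable_finsetSum _ fun j hj => hgint j ?_
    rw [stagesFrom_succ, Finset.mem_Ioi] at hj
    exact hj.le
  have hΦint : Integrable Φ (Measure.pi μ) :=
    integrable_finsetSum _ fun j hj => hint j (by simpa [mem_stagesFrom] using hj)
  have hcomp : ∀ p : ℝ × (Fin k → ℝ), Φ (Function.update p.2 i p.1)
      = f i (Function.update v i p.1) + ∑ j ∈ stagesFrom i.succ, g j p := fun p => by
    simp only [hΦ, hg, prepend_castSucc_update, sum_stagesFrom_castSucc, hconst]
  have hprod : Integrable (fun p : ℝ × (Fin k → ℝ) => Φ (Function.update p.2 i p.1))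
      ((μ i).prod (Measure.pi μ)) := hmp.integrable_comp_of_integrable hΦint
  have hae : ∀ᵐ t ∂(μ i), ∫ w, Φ (Function.update w i t) ∂(Measure.pi μ)
      = f i (Function.update v i t) + rewardToGo μ f i.succ (Function.update v i t) := by
    filter_upwards [hsum.prod_right_ae] with t ht
    have : ∀ w, Φ (Function.update w i t)
      = f i (Function.update v i t) + ∑ j ∈ stagesFrom i.succ, g j (t, w) := fun w => hcomp (t, w)
    simp only [this]
    rw [integral_add (integrable_const _) ht]
    simp [rewardToGo, hg]
  refine ⟨hprod.integral_prod_left.congr hae, ?_⟩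
  rw [← integral_congr_ae hae, ← integral_prod _ hprod]
  have hmap := integral_map (f := Φ) hmp.aemeasurable
    (by rw [hmp.map_eq]; exact hΦint.aestronglyMeasurable)
  rw [hmp.map_eq] at hmap
  exact hmap

end RewardToGo

/-! ### Value laws and the shape of the tradeoff functions -/

/-- `μ` is the law of a nonnegative value in `[a, b]` whose smallest possible value is `a`. -/
structure IsValueLaw (μ : Measure ℝ) (a b : ℝ) : Prop where
  nonneg : 0 ≤ a
  ae_mem : ∀ᵐ t ∂μ, t ∈ Icc a b
  low : ∀ t, a < t → 0 < μ (Iio t)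

/-- The properties of a tradeoff function on the states `c ≥ 0` that the backward recursion
preserves.  The values at negative states carry no meaning; continuity and monotonicity are asked on
the whole line, which a constant extension to the left of `0` provides.  The linear bound says that
the slope at `0` is finite, and it is what makes the recursion preserve continuity at `0`. -/
structure IsTradeoffShape (G : ℝ → ℝ) : Prop where
  continuous : Continuous G
  monotone : Monotone G
  concaveOn : ConcaveOn ℝ (Ici 0) G
  nonneg : ∀ c, 0 ≤ G c
  bounded : ∃ C, ∀ c, G c ≤ C
  le_linear : ∃ K, ∀ c, 0 ≤ c → G c ≤ G 0 + K * c

/-- The extended-real function that is `G` on `c ≥ 0` and `-∞` on `c < 0`. -/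
noncomputable def extendBot (G : ℝ → ℝ) (c : ℝ) : EReal := if 0 ≤ c then (G c : EReal) else ⊥

/-- The stage objective at state `c` and allocation probability `y` for a real-valued tradeoff
function `G`. -/
noncomputable def realObjective (μ : Measure ℝ) (G : ℝ → ℝ) (c y : ℝ) : ℝ :=
  ∫ v, G (y * (v - mean μ) + c) ∂μ + y * mean μ

section Shape

variable {μ : Measure ℝ} {a b : ℝ} {G : ℝ → ℝ}

theorem extExpectation_congr {f g : ℝ → EReal} (h : f =ᵐ[μ] g) :
    extExpectation μ f = extExpectation μ g := by
  unfold extExpectation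
  rw [lintegral_congr_ae (h.mono fun v hv => by rw [hv]),
    lintegral_congr_ae (f := fun v => (-(f v)).toENNReal) (g := fun v => (-(g v)).toENNReal)
      (h.mono fun v hv => by simp only [hv])]

theorem extExpectation_mono {f g : ℝ → EReal} (h : f ≤ g) :
    extExpectation μ f ≤ extExpectation μ g := by
  unfold extExpectation
  refine EReal.sub_le_sub ?_ ?_
  · exact_mod_cast lintegral_mono fun v => EReal.toENNReal_le_toENNReal (h v)
  · exact_mod_cast lintegral_mono fun v =>
      EReal.toENNReal_le_toENNReal (EReal.neg_le_neg_iff.2 (h v))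

theorem extExpectation_coe {f : ℝ → ℝ} (hf : Integrable f μ) (h0 : ∀ v, 0 ≤ f v) :
    extExpectation μ (fun v => (f v : EReal)) = ((∫ v, f v ∂μ : ℝ) : EReal) := by
  unfold extExpectation
  have h1 : ∀ v, ((f v : ℝ) : EReal).toENNReal = ENNReal.ofReal (f v) := fun v => by
    simp [EReal.toENNReal_of_ne_top]
  have h2 : ∀ v, (-((f v : ℝ) : EReal)).toENNReal = 0 := fun v => by
    rw [EReal.toENNReal_eq_zero_iff]
    exact_mod_cast neg_nonpos.2 (h0 v)
  simp only [h1, h2, lintegral_zero]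
  rw [← ofReal_integral_eq_lintegral_ofReal hf (Eventually.of_forall h0),
    EReal.coe_ennreal_ofReal, max_eq_left (integral_nonneg h0)]
  simp

theorem extExpectation_eq_bot {f : ℝ → EReal} {s : Set ℝ} (hsm : MeasurableSet s)
    (hs : μ s ≠ 0) (hf : ∀ v ∈ s, f v = ⊥) :
    extExpectation μ f = ⊥ := by
  have htop : ∫⁻ v, (-(f v)).toENNReal ∂μ = ⊤ := by
    rw [← top_le_iff]
    calc (⊤ : ℝ≥0∞) = ∫⁻ _ in s, ⊤ ∂μ := by simp [hs]
      _ ≤ ∫⁻ v in s, (-(f v)).toENNReal ∂μ := setLIntegral_mono' hsm fun v hv => by simp [hf v hv]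
      _ ≤ _ := setLIntegral_le_lintegral _ _
  simp [extExpectation, htop]

variable [IsProbabilityMeasure μ]

namespace IsValueLaw

theorem le (h : IsValueLaw μ a b) : a ≤ b := by
  obtain ⟨t, ht⟩ := h.ae_mem.exists
  exact ht.1.trans ht.2

theorem integrable_of_bounded (h : IsValueLaw μ a b) {f : ℝ → ℝ} (hf : AEStronglyMeasurable f μ)
    {C : ℝ} (hC : ∀ t ∈ Icc a b, |f t| ≤ C) : Integrable f μ :=
  Integrable.of_bound hf C (h.ae_mem.mono fun t ht => hC t ht)

theorem integrable_id (h : IsValueLaw μ a b) : Integrable (fun t : ℝ => t) μ :=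
  h.integrable_of_bounded (C := max |a| |b|) (by fun_prop) fun _ ht =>
    abs_le_max_abs_abs ht.1 ht.2

theorem le_mean (h : IsValueLaw μ a b) : a ≤ mean μ := by
  have := integral_mono_ae (integrable_const a) h.integrable_id (h.ae_mem.mono fun t ht => ht.1)
  simpa [mean] using this

theorem mean_nonneg (h : IsValueLaw μ a b) : 0 ≤ mean μ := h.nonneg.trans h.le_mean

theorem integral_affine (h : IsValueLaw μ a b) (y c : ℝ) :
    ∫ v, (y * (v - mean μ) + c) ∂μ = c := by
  have h1 : Integrable (fun v => v - mean μ) μ := h.integrable_id.sub (integrable_const _)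
  rw [integral_add (h1.const_mul y) (integrable_const _),
    integral_const_mul, integral_sub h.integrable_id (integrable_const _)]
  simp [mean]

theorem integrable_affine (h : IsValueLaw μ a b) (y c : ℝ) :
    Integrable (fun v => y * (v - mean μ) + c) μ :=
  ((h.integrable_id.sub (integrable_const _)).const_mul _).add (integrable_const _)

end IsValueLaw

theorem affine_nonneg {y c m t : ℝ} (hy : 0 ≤ y) (hc : y * (m - a) ≤ c) (ht : a ≤ t) :
    0 ≤ y * (t - m) + c := by
  nlinarith

theorem IsTradeoffShape.integrable_comp (hG : IsTradeoffShape G) {f : ℝ → ℝ}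
    (hf : AEStronglyMeasurable f μ) : Integrable (fun v => G (f v)) μ := by
  obtain ⟨C, hC⟩ := hG.bounded
  refine Integrable.of_bound (hG.continuous.comp_aestronglyMeasurable hf) C
    (Eventually.of_forall fun v => ?_)
  rw [Real.norm_of_nonneg (hG.nonneg _)]
  exact hC _

theorem IsTradeoffShape.integrable_affine (hG : IsTradeoffShape G) (y c m : ℝ) :
    Integrable (fun v => G (y * (v - m) + c)) μ :=
  hG.integrable_comp (by fun_prop)

/-- A state below `y * (E v - a)` makes the next state negative with positive probability; at the
other states the objective is real. -/
theorem stageObjective_extendBot (h : IsValueLaw μ a b) (hG : IsTradeoffShape G) {c y : ℝ}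
    (hy : 0 ≤ y) : stageObjective μ (extendBot G) c y
      = if y * (mean μ - a) ≤ c then (realObjective μ G c y : EReal) else ⊥ := by
  unfold stageObjective
  split_ifs with hc
  · rw [extExpectation_congr (g := fun v => ((G (y * (v - mean μ) + c) : ℝ) : EReal))
      (h.ae_mem.mono fun v hv => by simp [extendBot, affine_nonneg hy hc hv.1]),
      extExpectation_coe (hG.integrable_affine _ _ _) fun v => hG.nonneg _, realObjective]
    norm_cast
  · push Not at hc
    obtain ⟨t, hat, ht⟩ : ∃ t, a < t ∧ ∀ v < t, y * (v - mean μ) + c < 0 := by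
      rcases hy.eq_or_lt with rfl | hy
      · exact ⟨a + 1, by linarith, fun v _ => by linarith⟩
      · refine ⟨mean μ - c / y, ?_, fun v hv => ?_⟩
        · have : c / y < mean μ - a := by rwa [div_lt_iff₀' hy]
          linarith
        · have : v - mean μ < - (c / y) := by linarith
          have := mul_lt_mul_of_pos_left this hy
          rw [mul_neg, mul_div_cancel₀ _ hy.ne'] at this
          linarith
    rw [extExpectation_eq_bot (s := Iio t) measurableSet_Iio (h.low t hat).ne' fun v hv => by
      simp [extendBot, ht v hv], EReal.bot_add]

theorem continuous_realObjective (hG : IsTradeoffShape G) (c : ℝ) :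
    Continuous (realObjective μ G c) := by
  obtain ⟨C, hC⟩ := hG.bounded
  refine Continuous.add (continuous_of_dominated (bound := fun _ => C)
    (fun y => (hG.integrable_affine y c _).aestronglyMeasurable)
    (fun y => Eventually.of_forall fun v => ?_) (integrable_const _)
    (Eventually.of_forall fun v => ?_)) (by fun_prop)
  · rw [Real.norm_of_nonneg (hG.nonneg _)]
    exact hC _
  · exact hG.continuous.comp (by fun_prop)

/-- The allocation probabilities that keep every possible next state nonnegative. -/
def safeAllocations (m a c : ℝ) : Set ℝ := {y | y ∈ Icc (0 : ℝ) 1 ∧ y * (m - a) ≤ c}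

theorem zero_mem_safeAllocations {m a c : ℝ} (hc : 0 ≤ c) : 0 ∈ safeAllocations m a c :=
  ⟨by simp, by simpa using hc⟩

theorem isCompact_safeAllocations (m a c : ℝ) : IsCompact (safeAllocations m a c) :=
  isCompact_Icc.inter_right
    (isClosed_le (f := fun y : ℝ => y * (m - a)) (by fun_prop) continuous_const)

theorem exists_isGreatest_realObjective (hG : IsTradeoffShape G) (a : ℝ) {c : ℝ} (hc : 0 ≤ c) :
    ∃ g, IsGreatest (realObjective μ G c '' safeAllocations (mean μ) a c) g :=
  ((isCompact_safeAllocations _ _ _).image (continuous_realObjective hG c)).exists_isGreatest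
    (Set.Nonempty.image _ ⟨0, zero_mem_safeAllocations hc⟩)

/-- A monotone concave function on `[0, ∞)`, constant to the left of `0`, whose increments from `0`
are at most linear, is Lipschitz and hence continuous. -/
theorem continuous_of_concaveOn_of_le_linear {K : ℝ} (hmono : MonotoneOn G (Ici 0))
    (hconc : ConcaveOn ℝ (Ici 0) G) (hlin : ∀ c, 0 ≤ c → G c ≤ G 0 + K * c)
    (hmax : ∀ c, G c = G (max c 0)) : Continuous G := by
  have key : ∀ x y, 0 ≤ x → x ≤ y → G y - G x ≤ K * (y - x) := by
    intro x y hx hxy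
    rcases hx.eq_or_lt with rfl | hx
    · have := hlin y hxy
      linarith
    rcases hxy.eq_or_lt with rfl | hxy
    · simp
    have h1 := hconc.slope_anti_adjacent (mem_Ici.2 (le_refl (0 : ℝ)))
      (mem_Ici.2 (hx.trans hxy).le) hx hxy
    have h2 : (G x - G 0) / (x - 0) ≤ K := by
      rw [div_le_iff₀ (by linarith)]
      have := hlin x hx.le
      linarith
    have h3 := h1.trans h2
    rwa [div_le_iff₀ (by linarith)] at h3
  have hK : 0 ≤ K := by
    have h1 := hlin 1 zero_le_one
    have h2 := hmono (mem_Ici.2 (le_refl (0 : ℝ))) (mem_Ici.2 (zero_le_one (α := ℝ)))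
      zero_le_one
    linarith
  refine (LipschitzWith.of_le_add_mul K.toNNReal fun x y => ?_).continuous
  rw [Real.coe_toNNReal _ hK, hmax x, hmax y]
  have hd : |max x 0 - max y 0| ≤ dist x y := abs_max_sub_max_le_abs x y 0
  have hd' := mul_le_mul_of_nonneg_left hd hK
  rcases le_total (max y 0) (max x 0) with h | h
  · have := key _ _ (le_max_right y 0) h
    rw [abs_of_nonneg (sub_nonneg.2 h)] at hd'
    linarith
  · have := hmono (le_max_right x 0) (le_max_right y 0) h
    have := mul_nonneg hK (dist_nonneg (x := x) (y := y))
    linarith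

/-- One step of the backward recursion preserves the shape of the tradeoff function. -/
theorem exists_shape_step (h : IsValueLaw μ a b) (hG : IsTradeoffShape G) :
    ∃ G', IsTradeoffShape G' ∧
      (∀ c, 0 ≤ c → IsGreatest (realObjective μ G c '' safeAllocations (mean μ) a c) (G' c)) ∧
      ∀ c, ⨆ y ∈ Icc (0 : ℝ) 1, stageObjective μ (extendBot G) c y = extendBot G' c := by
  set m := mean μ with hm
  have hma : 0 ≤ m - a := sub_nonneg.2 h.le_mean
  have hm0 : 0 ≤ m := h.mean_nonneg
  choose! g hg using fun c (hc : (0 : ℝ) ≤ c) =>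
    exists_isGreatest_realObjective (μ := μ) hG a hc
  have hmem : ∀ c, 0 ≤ c → ∃ y ∈ safeAllocations m a c, realObjective μ G c y = g c :=
    fun c hc => (hg c hc).1
  have hub : ∀ c, 0 ≤ c → ∀ y ∈ safeAllocations m a c, realObjective μ G c y ≤ g c :=
    fun c hc y hy => (hg c hc).2 (mem_image_of_mem _ hy)
  have hmono : ∀ c c', 0 ≤ c → c ≤ c' → g c ≤ g c' := by
    intro c c' hc hcc
    obtain ⟨y, hy, hyg⟩ := hmem c hc
    rw [← hyg]
    refine le_trans ?_ (hub c' (hc.trans hcc) y ⟨hy.1, hy.2.trans hcc⟩)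
    exact add_le_add_left (integral_mono (hG.integrable_affine _ _ _) (hG.integrable_affine _ _ _)
      fun v => hG.monotone (by linarith)) _
  have hconc : ConcaveOn ℝ (Ici 0) g := by
    refine ⟨convex_Ici 0, fun c hc c' hc' α β hα hβ hαβ => ?_⟩
    obtain ⟨y, hy, hyg⟩ := hmem c hc
    obtain ⟨y', hy', hyg'⟩ := hmem c' hc'
    have hc₂ : (0 : ℝ) ≤ α • c + β • c' := convex_Ici (0 : ℝ) hc hc' hα hβ hαβ
    have hy₂ : α * y + β * y' ∈ safeAllocations m a (α • c + β • c') := by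
      refine ⟨convex_Icc (0 : ℝ) 1 hy.1 hy'.1 hα hβ hαβ, ?_⟩
      have h1 := mul_le_mul_of_nonneg_left hy.2 hα
      have h2 := mul_le_mul_of_nonneg_left hy'.2 hβ
      simp only [smul_eq_mul]
      linarith
    refine le_trans ?_ (hub _ hc₂ _ hy₂)
    rw [← hyg, ← hyg']
    simp only [realObjective, smul_eq_mul, mul_add, ← integral_const_mul]
    have h3 : ∫ v, (α * G (y * (v - m) + c)) ∂μ + ∫ v, (β * G (y' * (v - m) + c')) ∂μ
        ≤ ∫ v, G ((α * y + β * y') * (v - m) + (α * c + β * c')) ∂μ := by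
      rw [← integral_add ((hG.integrable_affine _ _ _).const_mul _)
        ((hG.integrable_affine _ _ _).const_mul _)]
      refine integral_mono_ae (((hG.integrable_affine _ _ _).const_mul _).add
        ((hG.integrable_affine _ _ _).const_mul _)) (hG.integrable_affine _ _ _)
        (h.ae_mem.mono fun v hv => ?_)
      have h4 := hG.concaveOn.2 (affine_nonneg hy.1.1 hy.2 hv.1)
        (affine_nonneg hy'.1.1 hy'.2 hv.1) hα hβ hαβ
      simp only [smul_eq_mul] at h4
      convert h4 using 2
      ring
    linarith
  obtain ⟨K, hK⟩ := hG.le_linear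
  -- At `c = 0` the safe allocation probabilities are only `0`, unless the value is deterministic.
  have hg0 : ∀ y ∈ Icc (0 : ℝ) 1, y * (m - a) ≤ 0 → G 0 + y * m ≤ g 0 := by
    intro y hy hy0
    refine le_trans ?_ (hub 0 le_rfl y ⟨hy, hy0⟩)
    refine add_le_add_left ?_ _
    calc G 0 = ∫ _, G 0 ∂μ := by simp
      _ ≤ _ := integral_mono_ae (integrable_const _) (hG.integrable_affine _ _ _)
        (h.ae_mem.mono fun v hv => hG.monotone (affine_nonneg hy.1 hy0 hv.1))
  have hlin₁ : ∀ c, 0 ≤ c → ∀ y ∈ safeAllocations m a c,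
      realObjective μ G c y ≤ G 0 + K * c + y * m := by
    intro c hc y hy
    refine add_le_add_left ?_ _
    calc ∫ v, G (y * (v - m) + c) ∂μ ≤ ∫ v, (G 0 + K * (y * (v - m) + c)) ∂μ :=
          integral_mono_ae (hG.integrable_affine _ _ _)
            ((integrable_const _).add ((h.integrable_affine y c).const_mul _))
            (h.ae_mem.mono fun v hv => hK _ (affine_nonneg hy.1.1 hy.2 hv.1))
      _ = G 0 + K * c := by
          rw [integral_add (integrable_const _) ((h.integrable_affine y c).const_mul _),
            integral_const_mul, h.integral_affine]
          simp
  have hlin : ∀ c, 0 ≤ c → g c ≤ g 0 + (K + m / (m - a)) * c := by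
    intro c hc
    obtain ⟨y, hy, hyg⟩ := hmem c hc
    have h1 := hlin₁ c hc y hy
    rw [hyg] at h1
    rcases hma.eq_or_lt with hma | hma
    · have h2 := hg0 y hy.1 (by rw [← hma, mul_zero])
      rw [← hma]
      simp only [div_zero, add_zero]
      linarith
    · have h2 := hg0 0 (by simp) (by simp)
      have h3 : y * m ≤ m / (m - a) * c := by
        rw [div_mul_eq_mul_div, le_div_iff₀ hma]
        nlinarith [hy.2]
      linarith
  have hgmax : ∀ c, 0 ≤ c → g (max c 0) = g c := fun c hc => by rw [max_eq_left hc]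
  refine ⟨fun c => g (max c 0), ⟨?_, ?_, ?_, ?_, ?_, ?_⟩, fun c hc => by
    simpa only [hgmax c hc] using hg c hc, fun c => ?_⟩
  · refine continuous_of_concaveOn_of_le_linear (K := K + m / (m - a)) ?_ ?_ ?_ ?_
    · intro c hc c' hc' hcc
      simpa only [hgmax c hc, hgmax c' hc'] using hmono c c' hc hcc
    · exact hconc.congr fun c hc => (hgmax c hc).symm
    · intro c hc
      simpa only [hgmax c hc, max_self] using hlin c hc
    · intro c
      simp
  · intro c c' hcc
    exact hmono _ _ (le_max_right _ _) (max_le_max_right _ hcc)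
  · exact hconc.congr fun c hc => (hgmax c hc).symm
  · intro c
    refine le_trans ?_ (hub _ (le_max_right c 0) 0 (zero_mem_safeAllocations (le_max_right _ _)))
    simpa [realObjective] using hG.nonneg _
  · obtain ⟨C, hC⟩ := hG.bounded
    refine ⟨C + m, fun c => ?_⟩
    obtain ⟨y, hy, hyg⟩ := hmem _ (le_max_right c 0)
    simp only [← hyg]
    refine add_le_add ?_ (mul_le_of_le_one_left hm0 hy.1.2)
    calc _ ≤ ∫ _, C ∂μ := integral_mono (hG.integrable_affine _ _ _) (integrable_const _)
          fun v => hC _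
      _ = C := by simp
  · exact ⟨K + m / (m - a), fun c hc => by simpa only [hgmax c hc, max_self] using hlin c hc⟩
  · refine le_antisymm (iSup₂_le fun y hy => ?_) ?_
    · rw [stageObjective_extendBot h hG hy.1]
      split_ifs with hc
      · have hc0 : 0 ≤ c := (mul_nonneg hy.1 hma).trans hc
        simpa [extendBot, hc0] using hub c hc0 y ⟨hy, hc⟩
      · exact bot_le
    · unfold extendBot
      split_ifs with hc
      · obtain ⟨y, hy, hyg⟩ := hmem c hc
        refine le_trans ?_ (le_iSup₂ (f := fun y (_ : y ∈ Icc (0 : ℝ) 1) =>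
          stageObjective μ (extendBot G) c y) y hy.1)
        simp only [stageObjective_extendBot h hG hy.1.1,
          if_pos (show y * (mean μ - a) ≤ c from hy.2), hyg, hgmax c hc, le_refl]
      · exact bot_le

end Shape

/-! ### Static mechanisms for one item -/

section Static

variable {μ : Measure ℝ} [IsProbabilityMeasure μ] {a b : ℝ} {G : ℝ → ℝ}

/-- In an incentive compatible static mechanism with allocation `x` and payment `p`, payments are
bounded by a finite mixture of posted prices: the prices are the grid points `τ (l + 1)`, weighted
by the increments of `x`, and each is paid by the types above the preceding grid point. -/
theorem payment_le_sum_grid {x p : ℝ → ℝ} (ha : 0 ≤ a)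
    (hic : ∀ s ∈ Icc a b, ∀ t ∈ Icc a b, t * x s - p s ≤ t * x t - p t)
    (hx : MonotoneOn x (Icc a b)) (hir : p a ≤ a * x a) {τ : ℕ → ℝ} (hτ : Monotone τ)
    (hτ0 : τ 0 = a) (n : ℕ) (hn : τ n ≤ b) :
    ∀ v ∈ Icc a (τ n), p v ≤ a * x a
      + ∑ l ∈ Finset.range n, τ (l + 1) * (x (τ (l + 1)) - x (τ l)) * (Ici (τ l)).indicator 1 v := by
  have hτa : ∀ l, a ≤ τ l := fun l => hτ0 ▸ hτ (Nat.zero_le l)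
  induction n with
  | zero =>
    intro v hv
    rw [hτ0] at hv
    have : v = a := le_antisymm hv.2 hv.1
    simpa [this] using hir
  | succ n ih =>
    intro v hv
    have hnn : τ n ≤ τ (n + 1) := hτ n.le_succ
    have ih := ih (hnn.trans hn)
    have hmemn : τ n ∈ Icc a b := ⟨hτa n, hnn.trans hn⟩
    have hmemn1 : τ (n + 1) ∈ Icc a b := ⟨hτa _, hn⟩
    have hΔ : 0 ≤ x (τ (n + 1)) - x (τ n) := sub_nonneg.2 (hx hmemn hmemn1 hnn)
    rw [Finset.sum_range_succ]
    rcases le_total v (τ n) with hvn | hvn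
    · have h1 := ih v ⟨hv.1, hvn⟩
      have h2 : 0 ≤ τ (n + 1) * (x (τ (n + 1)) - x (τ n)) * (Ici (τ n)).indicator 1 v :=
        mul_nonneg (mul_nonneg (ha.trans (hτa _)) hΔ) (indicator_nonneg (by simp) _)
      linarith
    · have h1 := ih (τ n) ⟨hτa n, le_rfl⟩
      have hvb : v ∈ Icc a b := ⟨hv.1, hv.2.trans hn⟩
      -- payments are monotone, so `p v` is at most the payment of the next grid point
      have h2 := hic v hvb _ hmemn1
      have h2' := hic _ hmemn1 v hvb
      have h3 := hic _ hmemn _ hmemn1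
      have h4 : x v ≤ x (τ (n + 1)) := hx hvb hmemn1 hv.2
      have h5 : p v ≤ p (τ (n + 1)) := by nlinarith [ha.trans hv.1]
      have h6 : ∑ l ∈ Finset.range n,
            τ (l + 1) * (x (τ (l + 1)) - x (τ l)) * (Ici (τ l)).indicator 1 (τ n)
          = ∑ l ∈ Finset.range n,
            τ (l + 1) * (x (τ (l + 1)) - x (τ l)) * (Ici (τ l)).indicator 1 v := by
        refine Finset.sum_congr rfl fun l hl => ?_
        have hl' : τ l ≤ τ n := hτ (Finset.mem_range.1 hl).le
        simp [indicator, hl', hl'.trans hvn]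
      have h7 : (Ici (τ n)).indicator (1 : ℝ → ℝ) v = 1 := by simp [indicator, hvn]
      rw [h7, mul_one, ← h6]
      linarith

/-- The revenue of an incentive compatible and individually rational static mechanism is at most any
bound `R` on the revenues of posted prices. -/
theorem integral_payment_le (h : IsValueLaw μ a b) {x p : ℝ → ℝ}
    (hic : ∀ s ∈ Icc a b, ∀ t ∈ Icc a b, t * x s - p s ≤ t * x t - p t)
    (hx : MonotoneOn x (Icc a b)) (hx01 : ∀ t ∈ Icc a b, x t ∈ Icc (0 : ℝ) 1)
    (hir : p a ≤ a * x a) (hp : Integrable p μ) {R : ℝ} (hR : ∀ s, s * μ.real (Ici s) ≤ R) :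
    ∫ t, p t ∂μ ≤ R := by
  have hR0 : 0 ≤ R := by simpa using hR 0
  have hab := h.le
  have hbound : ∀ N : ℕ, ∫ t, p t ∂μ ≤ R + (b - a) * (1 / ((N : ℝ) + 1)) := by
    intro N
    set δ := (b - a) * (1 / ((N : ℝ) + 1)) with hδ
    have hδ0 : 0 ≤ δ := by have := sub_nonneg.2 hab; positivity
    have hδN : δ * ((N : ℝ) + 1) = b - a := by rw [hδ]; field_simp
    set τ : ℕ → ℝ := fun l => a + δ * l with hτ
    have hτm : Monotone τ := fun l l' hl => by
      have : (l : ℝ) ≤ l' := by exact_mod_cast hl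
      simp only [hτ]
      gcongr
    have hτ0 : τ 0 = a := by simp [hτ]
    have hτN : τ (N + 1) = b := by simp only [hτ]; push_cast; linarith
    have hmem : ∀ l ≤ N + 1, τ l ∈ Icc a b := fun l hl => ⟨hτ0 ▸ hτm l.zero_le, hτN ▸ hτm hl⟩
    have hpt := payment_le_sum_grid h.nonneg hic hx hir hτm hτ0 (N + 1) hτN.le
    rw [hτN] at hpt
    have hint : ∀ l, Integrable (fun v => τ (l + 1) * (x (τ (l + 1)) - x (τ l))
        * (Ici (τ l)).indicator 1 v) μ := fun l =>
      ((integrable_const (1 : ℝ)).indicator measurableSet_Ici).const_mul _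
    have hterm : ∀ l ∈ Finset.range (N + 1), ∫ v, τ (l + 1) * (x (τ (l + 1)) - x (τ l))
        * (Ici (τ l)).indicator 1 v ∂μ ≤ (R + δ) * (x (τ (l + 1)) - x (τ l)) := by
      intro l hl
      have hl := Finset.mem_range.1 hl
      have hΔ : 0 ≤ x (τ (l + 1)) - x (τ l) :=
        sub_nonneg.2 (hx (hmem _ hl.le) (hmem _ hl) (hτm l.le_succ))
      rw [integral_const_mul, integral_indicator_one measurableSet_Ici, mul_right_comm]
      refine mul_le_mul_of_nonneg_right ?_ hΔ
      have h1 : τ (l + 1) = τ l + δ := by simp only [hτ]; push_cast; ring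
      have h2 : δ * μ.real (Ici (τ l)) ≤ δ := mul_le_of_le_one_right hδ0 measureReal_le_one
      rw [h1, add_mul]
      exact add_le_add (hR _) h2
    have ha1 : a ≤ R := by
      have h1 : μ.real (Ici a) = 1 := by
        rw [measureReal_def, (mem_ae_iff_prob_eq_one measurableSet_Ici).1
          (h.ae_mem.mono fun t ht => ht.1), ENNReal.toReal_one]
      simpa [h1] using hR a
    have hxa := hx01 a ⟨le_rfl, hab⟩
    have hxb := hx01 b ⟨hab, le_rfl⟩
    calc ∫ t, p t ∂μ ≤ ∫ v, (a * x a + ∑ l ∈ Finset.range (N + 1),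
            τ (l + 1) * (x (τ (l + 1)) - x (τ l)) * (Ici (τ l)).indicator 1 v) ∂μ :=
          integral_mono_ae hp ((integrable_const _).add (integrable_finsetSum _ fun l _ => hint l))
            (h.ae_mem.mono hpt)
      _ = a * x a + ∑ l ∈ Finset.range (N + 1), ∫ v,
            τ (l + 1) * (x (τ (l + 1)) - x (τ l)) * (Ici (τ l)).indicator 1 v ∂μ := by
          rw [integral_add (integrable_const _) (integrable_finsetSum _ fun l _ => hint l),
            integral_finsetSum _ fun l _ => hint l]
          simp
      _ ≤ R * x a + ∑ l ∈ Finset.range (N + 1), (R + δ) * (x (τ (l + 1)) - x (τ l)) :=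
          add_le_add (mul_le_mul_of_nonneg_right ha1 hxa.1) (Finset.sum_le_sum hterm)
      _ = R * x a + (R + δ) * (x b - x a) := by
          rw [← Finset.mul_sum, Finset.sum_range_sub (fun l => x (τ l)), hτN, hτ0]
      _ ≤ R + δ := by nlinarith [hxa.1, hxb.2]
  refine ge_of_tendsto' (x := atTop) (f := fun N : ℕ => R + (b - a) * (1 / ((N : ℝ) + 1))) ?_ hbound
  have := (tendsto_one_div_add_atTop_nhds_zero_nat (𝕜 := ℝ)).const_mul (b - a)
  simpa using this.const_add R

/-- If `W` crosses the nondecreasing function `L` once, from below, and has the same mean, then it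
is riskier than `L`: expectations of concave functions are smaller.  By concavity, the chord slopes
of `G` on the two sides of the crossing are separated by a constant, which serves as a supergradient. -/
theorem integral_concave_le_of_single_crossing (h : IsValueLaw μ a b) (hG : IsTradeoffShape G)
    {W L : ℝ → ℝ} (hW : Integrable W μ) (hL : Integrable L μ) (hWL : ∫ t, W t ∂μ = ∫ t, L t ∂μ)
    (hW0 : ∀ t ∈ Icc a b, 0 ≤ W t) (hL0 : ∀ t ∈ Icc a b, 0 ≤ L t) (hLm : Monotone L)
    (hcross : ∀ s ∈ Icc a b, ∀ t ∈ Icc a b, W s < L s → L t < W t → s ≤ t) :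
    ∫ t, G (W t) ∂μ ≤ ∫ t, G (L t) ∂μ := by
  by_cases hneg : ∃ s ∈ Icc a b, W s < L s
  swap
  · push Not at hneg
    have h1 := (integral_eq_iff_of_ae_le hL hW (h.ae_mem.mono hneg)).1 hWL.symm
    exact (integral_congr_ae (h1.mono fun t ht => by simp only [ht])).ge
  by_cases hpos : ∃ t ∈ Icc a b, L t < W t
  swap
  · push Not at hpos
    have h1 := (integral_eq_iff_of_ae_le hW hL (h.ae_mem.mono hpos)).1 hWL
    exact (integral_congr_ae (h1.mono fun t ht => by simp only [ht])).le
  have hslope : ∀ s ∈ Icc a b, ∀ t ∈ Icc a b, W s < L s → L t < W t →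
      (G (W t) - G (L t)) / (W t - L t) ≤ (G (L s) - G (W s)) / (L s - W s) := by
    intro s hs t ht hsW htW
    have hst : L s ≤ L t := hLm (hcross s hs t ht hsW htW)
    rcases hst.eq_or_lt with heq | hlt
    · rw [← heq] at htW ⊢
      exact hG.concaveOn.slope_anti_adjacent (hW0 s hs) (hW0 t ht) hsW htW
    · exact (hG.concaveOn.slope_anti_adjacent (hL0 s hs) (hW0 t ht) hlt htW).trans
        (hG.concaveOn.slope_anti_adjacent (hW0 s hs) (hL0 t ht) hsW hlt)
  obtain ⟨s₀, hs₀, hs₀W⟩ := hneg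
  obtain ⟨t₀, ht₀, ht₀W⟩ := hpos
  set S : Set ℝ := {q | ∃ t ∈ Icc a b, L t < W t ∧ q = (G (W t) - G (L t)) / (W t - L t)} with hS
  have hSne : S.Nonempty := ⟨_, t₀, ht₀, ht₀W, rfl⟩
  have hSle : ∀ s ∈ Icc a b, W s < L s → ∀ q ∈ S, q ≤ (G (L s) - G (W s)) / (L s - W s) := by
    rintro s hs hsW q ⟨t, ht, htW, rfl⟩
    exact hslope s hs t ht hsW htW
  have hSb : BddAbove S := ⟨_, hSle s₀ hs₀ hs₀W⟩
  set σ := sSup S with hσ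
  have hpt : ∀ t ∈ Icc a b, G (W t) ≤ G (L t) + σ * (W t - L t) := by
    intro t ht
    rcases lt_trichotomy (W t) (L t) with hlt | heq | hgt
    · have h1 : σ ≤ _ := csSup_le hSne (hSle t ht hlt)
      rw [le_div_iff₀ (sub_pos.2 hlt)] at h1
      linarith
    · simp [heq]
    · have h1 : (G (W t) - G (L t)) / (W t - L t) ≤ σ := le_csSup hSb ⟨t, ht, hgt, rfl⟩
      rw [div_le_iff₀ (sub_pos.2 hgt)] at h1
      linarith
  have hGL : Integrable (fun t => G (L t)) μ := hG.integrable_comp hL.aestronglyMeasurable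
  have hσint : Integrable (fun t => σ * (W t - L t)) μ := (hW.sub hL).const_mul σ
  calc ∫ t, G (W t) ∂μ ≤ ∫ t, (G (L t) + σ * (W t - L t)) ∂μ :=
        integral_mono_ae (hG.integrable_comp hW.aestronglyMeasurable)
          (hGL.add hσint) (h.ae_mem.mono hpt)
    _ = ∫ t, G (L t) ∂μ := by
        rw [integral_add hGL hσint, integral_const_mul, integral_sub hW hL, hWL]
        simp

/-- The one-stage comparison.  Let `W` be the utility curve of an incentive compatible static
mechanism with allocation `x`.  The line with the same value at `a` and the same mean as `W` is less
risky than the convex function `W`, and its slope `y` gives the welfare up to a monopoly revenue. -/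
theorem exists_constant_allocation (h : IsValueLaw μ a b) (hG : IsTradeoffShape G) {x W : ℝ → ℝ}
    (hic : ∀ s ∈ Icc a b, ∀ t ∈ Icc a b, W s + (t - s) * x s ≤ W t)
    (hx01 : ∀ t ∈ Icc a b, x t ∈ Icc (0 : ℝ) 1) (hW0 : ∀ t ∈ Icc a b, 0 ≤ W t)
    (hxint : Integrable (fun t => t * x t) μ) (hW : Integrable W μ) {R : ℝ}
    (hR : ∀ s, s * μ.real (Ici s) ≤ R) :
    ∃ y ∈ safeAllocations (mean μ) a (∫ t, W t ∂μ),
      ∫ t, t * x t ∂μ + ∫ t, G (W t) ∂μ ≤ R + realObjective μ G (∫ t, W t ∂μ) y := by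
  set m := mean μ with hm
  set c := ∫ t, W t ∂μ with hc
  have haI : a ∈ Icc a b := ⟨le_rfl, h.le⟩
  have hma : 0 ≤ m - a := sub_nonneg.2 h.le_mean
  have hWa : W a ≤ c := by
    have := integral_mono_ae (integrable_const (W a)) hW (h.ae_mem.mono fun t ht => by
      have h1 := hic a haI t ht
      have h2 := mul_nonneg (sub_nonneg.2 ht.1) (hx01 a haI).1
      show W a ≤ W t
      linarith)
    simpa using this
  have hWa' : c - W a ≤ m - a := by
    have := integral_mono_ae hW ((h.integrable_id).sub (integrable_const (a - W a)))
      (h.ae_mem.mono fun t ht => by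
        have h1 := hic t ht a haI
        have h2 := mul_le_mul_of_nonneg_left (hx01 t ht).2 (sub_nonneg.2 ht.1)
        show W t ≤ t - (a - W a)
        linarith)
    simp only [Pi.sub_apply] at this
    rw [integral_sub h.integrable_id (integrable_const _)] at this
    simp only [integral_const, probReal_univ, one_smul] at this
    have h3 : m = ∫ t, t ∂μ := rfl
    linarith
  -- If the value is deterministic, then `m = a` and `y = 0` by the convention for division by zero.
  set y := (c - W a) / (m - a) with hy
  have hyma : y * (m - a) = c - W a := by
    rcases hma.eq_or_lt with h0 | h0
    · rw [← h0] at hWa' ⊢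
      linarith
    · rw [hy, div_mul_cancel₀ _ h0.ne']
  have hy0 : 0 ≤ y := div_nonneg (sub_nonneg.2 hWa) hma
  have hy1 : y ≤ 1 := div_le_one_of_le₀ hWa' hma
  have hyc : y * (m - a) ≤ c := by
    have := hW0 a haI
    linarith
  refine ⟨y, ⟨⟨hy0, hy1⟩, hyc⟩, ?_⟩
  have hwelfare : ∫ t, t * x t ∂μ ≤ R + y * m := by
    have hWint : Integrable (fun t => W t - W a) μ := hW.sub (integrable_const _)
    have hint : Integrable (fun t => t * x t - (W t - W a)) μ := hxint.sub hWint
    have hmono : MonotoneOn x (Icc a b) := by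
      intro s hs t ht hst
      rcases hst.eq_or_lt with rfl | hst
      · exact le_rfl
      have h1 := hic s hs t ht
      have h2 := hic t ht s hs
      nlinarith
    have h1 := integral_payment_le h (p := fun t => t * x t - (W t - W a)) (fun s hs t ht => by
      have := hic s hs t ht
      linarith) hmono hx01 (by simp) hint hR
    rw [integral_sub hxint hWint, integral_sub hW (integrable_const _)] at h1
    simp only [integral_const, probReal_univ, one_smul] at h1
    have h2 := mul_nonneg hy0 h.nonneg
    linarith
  have hrisk : ∫ t, G (W t) ∂μ ≤ ∫ t, G (y * (t - m) + c) ∂μ := by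
    refine integral_concave_le_of_single_crossing h hG hW (h.integrable_affine y c)
      (h.integral_affine y c).symm hW0 (fun t ht => affine_nonneg hy0 hyc ht.1)
      (fun s t hst => ?_) fun s hs t ht hsW htW => ?_
    · have := mul_le_mul_of_nonneg_left (sub_le_sub_right hst m) hy0
      simpa using this
    · by_contra hts
      push Not at hts
      have hat : a < t := by
        refine lt_of_le_of_ne ht.1 fun hat => ?_
        rw [← hat] at htW
        linarith
      have h1 := hic t ht a haI
      have h2 := hic t ht s hs
      -- being above the line at `t` forces a slope at `t` larger than that of the line
      have h3 : y < x t := by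
        by_contra hxy
        push Not at hxy
        have := mul_le_mul_of_nonneg_left hxy (sub_nonneg.2 ht.1)
        linarith
      have := mul_lt_mul_of_pos_left h3 (sub_pos.2 hts)
      linarith
  unfold realObjective
  linarith

end Static

/-! ### Existence of monopoly prices, optimal allocations and the initial state -/

section Existence

variable {μ : Measure ℝ} [IsProbabilityMeasure μ] {a b : ℝ} {G : ℝ → ℝ}

theorem IsMonopolyPrice.exists (h : IsValueLaw μ a b) : ∃ r, IsMonopolyPrice μ r := by
  have hb : 0 ≤ b := h.nonneg.trans h.le
  have husc : UpperSemicontinuousOn (fun s => s * μ.real (Ici s)) (Icc 0 b) := by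
    intro s hs t ht
    -- the upper tail is left-continuous, so it can be bounded from a point slightly below `s`
    have hInter : ⋂ n : ℕ, Ici (s - 1 / ((n : ℝ) + 1)) = Ici s := by
      ext x
      simp only [mem_iInter, mem_Ici]
      refine ⟨fun hx => ?_, fun hx n => ?_⟩
      · refine le_of_tendsto' (x := atTop) (f := fun n : ℕ => s - 1 / ((n : ℝ) + 1)) ?_ hx
        simpa using (tendsto_one_div_add_atTop_nhds_zero_nat (𝕜 := ℝ)).const_sub s
      · have : (0 : ℝ) < 1 / ((n : ℝ) + 1) := by positivity
        linarith
    have hanti : Antitone fun n : ℕ => Ici (s - 1 / ((n : ℝ) + 1)) := fun n n' hn =>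
      Ici_subset_Ici.2 (sub_le_sub_left (Nat.one_div_le_one_div hn) _)
    have hlim : Tendsto (fun n : ℕ => s * μ.real (Ici (s - 1 / ((n : ℝ) + 1)))) atTop
        (𝓝 (s * μ.real (Ici s))) := by
      refine Tendsto.const_mul s ?_
      have := tendsto_measure_iInter_atTop (μ := μ)
        (fun n : ℕ => (measurableSet_Ici (a := s - 1 / ((n : ℝ) + 1))).nullMeasurableSet)
        hanti ⟨0, measure_ne_top _ _⟩
      rw [hInter] at this
      exact (ENNReal.tendsto_toReal (measure_ne_top _ _)).comp this
    obtain ⟨n, hn⟩ := (hlim.eventually_lt_const ht).exists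
    set q := μ.real (Ici (s - 1 / ((n : ℝ) + 1))) with hq
    have h1 : ∀ᶠ s' in 𝓝[Icc 0 b] s, s' * q < t :=
      ((continuous_id.mul continuous_const).tendsto s).eventually_lt_const hn
        |>.filter_mono nhdsWithin_le_nhds
    have h2 : ∀ᶠ s' in 𝓝[Icc 0 b] s, s - 1 / ((n : ℝ) + 1) < s' :=
      (lt_mem_nhds (sub_lt_self s (by positivity))).filter_mono nhdsWithin_le_nhds
    filter_upwards [h1, h2, self_mem_nhdsWithin] with s' h1 h2 h3
    refine lt_of_le_of_lt (mul_le_mul_of_nonneg_left ?_ h3.1) h1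
    exact measureReal_mono (Ici_subset_Ici.2 h2.le)
  obtain ⟨r, hr, hmax⟩ := husc.exists_isMaxOn (nonempty_Icc.2 hb) isCompact_Icc
  have h0 : 0 ≤ r * μ.real (Ici r) := mul_nonneg hr.1 measureReal_nonneg
  refine ⟨r, fun s => ?_⟩
  rcases lt_or_ge s 0 with hs | hs
  · exact (mul_nonpos_of_nonpos_of_nonneg hs.le measureReal_nonneg).trans h0
  rcases le_or_gt s b with hsb | hsb
  · exact hmax ⟨hs, hsb⟩
  · have : μ (Ici s) = 0 := measure_mono_null
      (fun t (ht : s ≤ t) (h' : t ∈ Icc a b) => (hsb.trans_le ht).not_ge h'.2) h.ae_mem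
    simpa [measureReal_def, this] using h0

/-- Measurable selection of a maximizer.  The least maximizer is at most `t` if and only if the
maximum over `[0, t]` equals the maximum over `[0, 1]`, and both are monotone in the parameter. -/
theorem exists_measurable_maximizer {f : ℝ → ℝ → EReal} (hmono : ∀ y ∈ Icc (0 : ℝ) 1,
      Monotone fun c => f c y) (husc : ∀ c, UpperSemicontinuousOn (f c) (Icc 0 1)) :
    ∃ Y : ℝ → ℝ, Measurable Y ∧ ∀ c, Y c ∈ Icc (0 : ℝ) 1 ∧
      ∀ y ∈ Icc (0 : ℝ) 1, f c y ≤ f c (Y c) := by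
  set A : ℝ → Set ℝ := fun c => {y | y ∈ Icc (0 : ℝ) 1 ∧ ∀ y' ∈ Icc (0 : ℝ) 1, f c y' ≤ f c y}
    with hA
  have hAne : ∀ c, (A c).Nonempty := fun c => by
    obtain ⟨y, hy, hmax⟩ := (husc c).exists_isMaxOn ⟨0, by simp⟩ isCompact_Icc
    exact ⟨y, hy, fun y' hy' => hmax hy'⟩
  have hAbdd : ∀ c, BddBelow (A c) := fun c => ⟨0, fun y hy => hy.1.1⟩
  have hmem : ∀ c, sInf (A c) ∈ A c := by
    intro c
    have hI : sInf (A c) ∈ Icc (0 : ℝ) 1 := by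
      obtain ⟨y, hy⟩ := hAne c
      exact ⟨le_csInf (hAne c) fun y hy => hy.1.1, (csInf_le (hAbdd c) hy).trans hy.1.2⟩
    refine ⟨hI, fun y hy => ?_⟩
    by_contra hlt
    push Not at hlt
    have hcl := csInf_mem_closure (hAne c) (hAbdd c)
    have hev := eventually_nhdsWithin_iff.1 (husc c _ hI _ hlt)
    obtain ⟨z, hz, hzA⟩ := (mem_closure_iff_frequently.1 hcl).and_eventually hev |>.exists
    exact (hzA hz.1).not_ge (hz.2 y hy)
  set V : ℝ → ℝ → EReal := fun t c => ⨆ y ∈ Icc (0 : ℝ) t, f c y with hV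
  have hVm : ∀ t ≤ 1, Measurable (V t) := fun t ht => Monotone.measurable fun c c' hcc =>
    iSup₂_mono fun y hy => hmono y ⟨hy.1, hy.2.trans ht⟩ hcc
  refine ⟨fun c => sInf (A c), measurable_of_Iic fun t => ?_, hmem⟩
  rcases lt_or_ge t 0 with ht0 | ht0
  · convert MeasurableSet.empty
    ext c
    simpa using ht0.trans_le (hmem c).1.1
  rcases le_or_gt 1 t with ht1 | ht1
  · convert MeasurableSet.univ
    ext c
    simpa using (hmem c).1.2.trans ht1
  have hset : (fun c => sInf (A c)) ⁻¹' Iic t = {c | V t c = V 1 c} := by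
    ext c
    simp only [mem_preimage, mem_Iic, mem_ofPred_eq]
    constructor
    · intro h
      refine le_antisymm (biSup_mono fun y hy => ⟨hy.1, hy.2.trans ht1.le⟩)
        (iSup₂_le fun y hy => ((hmem c).2 y hy).trans ?_)
      exact le_iSup₂ (f := fun y (_ : y ∈ Icc (0 : ℝ) t) => f c y) (sInf (A c)) ⟨(hmem c).1.1, h⟩
    · intro h
      obtain ⟨y, hy, hmax⟩ := ((husc c).mono (Icc_subset_Icc_right ht1.le)).exists_isMaxOn
        ⟨0, by simpa using ht0⟩ isCompact_Icc
      refine (csInf_le (hAbdd c) ⟨⟨hy.1, hy.2.trans ht1.le⟩, fun y' hy' => ?_⟩).trans hy.2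
      calc f c y' ≤ V 1 c := le_iSup₂ (f := fun y (_ : y ∈ Icc (0 : ℝ) 1) => f c y) y' hy'
        _ = V t c := h.symm
        _ ≤ f c y := iSup₂_le fun z hz => hmax hz
  rw [hset]
  exact measurableSet_eq_fun (hVm t ht1.le) (hVm 1 le_rfl)

theorem extendBot_monotone (hG : IsTradeoffShape G) : Monotone (extendBot G) := by
  intro c c' hcc
  unfold extendBot
  split_ifs with h1 h2
  · exact_mod_cast hG.monotone hcc
  · exact absurd (h1.trans hcc) h2
  · exact bot_le
  · exact le_rfl

theorem exists_measurable_optimal_allocation (h : IsValueLaw μ a b) (hG : IsTradeoffShape G) :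
    ∃ Y : ℝ → ℝ, Measurable Y ∧ ∀ c, Y c ∈ Icc (0 : ℝ) 1 ∧ ∀ y ∈ Icc (0 : ℝ) 1,
      stageObjective μ (extendBot G) c y ≤ stageObjective μ (extendBot G) c (Y c) := by
  refine exists_measurable_maximizer (fun y hy c c' hcc => ?_) fun c => ?_
  · exact add_le_add_left (extExpectation_mono fun v => extendBot_monotone hG (by linarith)) _
  · intro y hy t ht
    rw [stageObjective_extendBot h hG hy.1] at ht
    split_ifs at ht with hc
    · have hcont : Continuous fun y => (realObjective μ G c y : EReal) :=
        continuous_coe_real_ereal.comp (continuous_realObjective hG c)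
      filter_upwards [((hcont.tendsto y).eventually_lt_const ht).filter_mono nhdsWithin_le_nhds,
        self_mem_nhdsWithin] with y' h1 h2
      rw [stageObjective_extendBot h hG h2.1]
      split_ifs
      · exact h1
      · exact bot_le.trans_lt h1
    · push Not at hc
      have hcont : Continuous fun y : ℝ => y * (mean μ - a) := by fun_prop
      filter_upwards [((hcont.tendsto y).eventually_const_lt hc).filter_mono nhdsWithin_le_nhds,
        self_mem_nhdsWithin] with y' h1 h2
      rw [stageObjective_extendBot h hG h2.1, if_neg (not_le.2 h1)]
      exact ht

/-- At a nonnegative state, an optimizer of the extended-real stage objective is a safe allocation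
probability. -/
theorem mem_safeAllocations_of_isMax (h : IsValueLaw μ a b) (hG : IsTradeoffShape G) {c y : ℝ}
    (hc : 0 ≤ c) (hy : y ∈ Icc (0 : ℝ) 1) (hmax : ∀ y' ∈ Icc (0 : ℝ) 1,
      stageObjective μ (extendBot G) c y' ≤ stageObjective μ (extendBot G) c y) :
    y ∈ safeAllocations (mean μ) a c ∧ ∀ y' ∈ safeAllocations (mean μ) a c,
      realObjective μ G c y' ≤ realObjective μ G c y := by
  have hsafe : y * (mean μ - a) ≤ c := by
    by_contra hyc
    have h0 := hmax 0 (by simp)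
    rw [stageObjective_extendBot h hG hy.1, if_neg hyc, stageObjective_extendBot h hG le_rfl,
      if_pos (by simpa using hc)] at h0
    exact EReal.coe_ne_bot _ (le_bot_iff.1 h0)
  refine ⟨⟨hy, hsafe⟩, fun y' hy' => ?_⟩
  have h1 := hmax y' hy'.1
  rw [stageObjective_extendBot h hG hy.1, if_pos hsafe, stageObjective_extendBot h hG hy'.1.1,
    if_pos hy'.2] at h1
  exact_mod_cast h1

theorem exists_isMax_sub_self (hG : IsTradeoffShape G) :
    ∃ c₀, ∀ c : ℝ, extendBot G c - (c : EReal) ≤ extendBot G c₀ - (c₀ : EReal) := by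
  obtain ⟨C, hC⟩ := hG.bounded
  have hC0 : 0 ≤ C := (hG.nonneg 0).trans (hC 0)
  obtain ⟨c₀, hc₀, hmax⟩ := isCompact_Icc.exists_isMaxOn (s := Icc 0 C) ⟨0, le_rfl, hC0⟩
    (hG.continuous.sub continuous_id).continuousOn
  refine ⟨c₀, fun c => ?_⟩
  rcases lt_or_ge c 0 with hc | hc
  · rw [extendBot, if_neg (not_le.2 hc), EReal.bot_sub]
    exact bot_le
  · rw [extendBot, if_pos hc, extendBot, if_pos hc₀.1]
    norm_cast
    rcases le_or_gt c C with hcC | hcC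
    · exact hmax ⟨hc, hcC⟩
    · have h1 : G 0 - 0 ≤ G c₀ - c₀ := hmax ⟨le_rfl, hC0⟩
      have h2 := hG.nonneg 0
      have h3 := hC c
      linarith

theorem nonneg_of_isMax_sub_self {c₀ : ℝ}
    (hmax : ∀ c : ℝ, extendBot G c - (c : EReal) ≤ extendBot G c₀ - (c₀ : EReal)) :
    0 ≤ c₀ ∧ ∀ c, 0 ≤ c → G c - c ≤ G c₀ - c₀ := by
  have hc₀ : 0 ≤ c₀ := by
    by_contra hc₀
    have h0 := hmax 0
    rw [extendBot, if_pos le_rfl, extendBot, if_neg hc₀, EReal.bot_sub] at h0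
    norm_cast at h0
  refine ⟨hc₀, fun c hc => ?_⟩
  have h1 := hmax c
  rw [extendBot, if_pos hc, extendBot, if_pos hc₀] at h1
  exact_mod_cast h1

end Existence

/-! ### The tradeoff functions as real-valued functions -/

/-- The tradeoff functions have real-valued versions of the right shape, which satisfy the recursion
with safe allocation probabilities. -/
theorem exists_real_tradeoff {k : ℕ} {μ : Fin k → Measure ℝ} [∀ i, IsProbabilityMeasure (μ i)]
    {a b : Fin k → ℝ} (h : ∀ i, IsValueLaw (μ i) (a i) (b i)) :
    ∃ G : Fin (k + 1) → ℝ → ℝ, (∀ n, IsTradeoffShape (G n)) ∧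
      (∀ n, tradeoff μ n = extendBot (G n)) ∧ (∀ c, 0 ≤ c → G (Fin.last k) c = 0) ∧
      ∀ i c, 0 ≤ c → IsGreatest (realObjective (μ i) (G i.succ) c ''
        safeAllocations (mean (μ i)) (a i) c) (G i.castSucc c) := by
  have hex : ∀ n : Fin (k + 1), ∃ G, IsTradeoffShape G ∧ tradeoff μ n = extendBot G := by
    refine Fin.reverseInduction ⟨fun _ => 0, ⟨continuous_const, monotone_const,
      concaveOn_const 0 (convex_Ici 0), fun _ => le_rfl, ⟨0, fun _ => le_rfl⟩,
      ⟨0, fun c _ => by simp⟩⟩, ?_⟩ fun i hi => ?_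
    · funext c
      simp [tradeoff_last, extendBot]
    · obtain ⟨G, hG, htr⟩ := hi
      obtain ⟨G', hG', -, hstep⟩ := exists_shape_step (h i) hG
      refine ⟨G', hG', ?_⟩
      funext c
      rw [tradeoff_castSucc, htr, hstep]
  choose G hG htr using hex
  have hinj : ∀ {g g' : ℝ → ℝ}, extendBot g = extendBot g' → ∀ c, 0 ≤ c → g c = g' c := by
    intro g g' hgg c hc
    have := congrFun hgg c
    rw [extendBot, extendBot, if_pos hc, if_pos hc] at this
    exact_mod_cast this
  refine ⟨G, hG, htr, fun c hc => ?_, fun i c hc => ?_⟩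
  · refine hinj (g' := fun _ => 0) ?_ c hc
    rw [← htr]
    funext c
    simp [tradeoff_last, extendBot]
  · obtain ⟨G', hG', hgr, hstep⟩ := exists_shape_step (h i) (hG i.succ)
    have : extendBot (G i.castSucc) = extendBot G' := by
      rw [← htr]
      funext c
      rw [tradeoff_castSucc, htr, hstep]
    rw [hinj this c hc]
    exact hgr c hc

theorem convex_hypograph_extendBot {G : ℝ → ℝ} (hG : IsTradeoffShape G) :
    Convex ℝ {q : ℝ × ℝ | (q.2 : EReal) ≤ extendBot G q.1} := by
  convert hG.concaveOn.convex_hypograph using 1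
  ext q
  by_cases hq : 0 ≤ q.1 <;> simp [extendBot, hq]

variable {k : ℕ} {μ : Fin k → Measure ℝ} {a b : Fin k → ℝ}

/-! ### States, payments and utilities of the state-based mechanism -/

theorem abs_mul_le_of_mem {v : Fin k → ℝ} (hv : v ∈ Icc a b) (i : Fin k) {x : ℝ}
    (hx : x ∈ Icc (0 : ℝ) 1) : |v i * x| ≤ max |a i| |b i| := by
  rw [abs_mul, abs_of_nonneg hx.1]
  exact (mul_le_of_le_one_right (abs_nonneg _) hx.2).trans (abs_le_max_abs_abs (hv.1 i) (hv.2 i))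

theorem state_congr (Y : Fin k → ℝ → ℝ) (c₀ : ℝ) (n : Fin (k + 1)) {v w : Fin k → ℝ}
    (hvw : ∀ j : Fin k, j.castSucc < n → v j = w j) : state μ Y c₀ v n = state μ Y c₀ w n := by
  induction n using Fin.induction with
  | zero => simp [state_zero]
  | succ i ih =>
    rw [state_succ, state_succ, ih fun j hj => hvw j (hj.trans i.castSucc_lt_succ),
      hvw i i.castSucc_lt_succ]

theorem state_update (Y : Fin k → ℝ → ℝ) (c₀ : ℝ) (v : Fin k → ℝ) (i : Fin k) (t : ℝ) :
    state μ Y c₀ (Function.update v i t) i.castSucc = state μ Y c₀ v i.castSucc :=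
  state_congr Y c₀ _ fun _ hj => Function.update_of_ne (Fin.castSucc_lt_castSucc_iff.1 hj).ne _ _

theorem measurable_state {Y : Fin k → ℝ → ℝ} (hY : ∀ i, Measurable (Y i)) (c₀ : ℝ)
    (n : Fin (k + 1)) : Measurable fun v => state μ Y c₀ v n := by
  induction n using Fin.induction with
  | zero => simp only [state_zero, measurable_const]
  | succ i ih =>
    simp only [state_succ]
    exact (((hY i).comp ih).mul ((measurable_pi_apply i).sub_const _)).add ih

theorem exists_abs_state_le {Y : Fin k → ℝ → ℝ} (hY : ∀ i c, Y i c ∈ Icc (0 : ℝ) 1) (c₀ : ℝ)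
    (n : Fin (k + 1)) : ∃ C, ∀ v ∈ Icc a b, |state μ Y c₀ v n| ≤ C := by
  induction n using Fin.induction with
  | zero => exact ⟨|c₀|, fun v _ => by rw [state_zero]⟩
  | succ i ih =>
    obtain ⟨C, hC⟩ := ih
    refine ⟨(max |a i| |b i| + |mean (μ i)|) + C, fun v hv => ?_⟩
    rw [state_succ]
    refine (abs_add_le _ _).trans (add_le_add ?_ (hC v hv))
    rw [abs_mul, abs_of_nonneg (hY i _).1]
    refine (mul_le_of_le_one_left (abs_nonneg _) (hY i _).2).trans ((abs_sub _ _).trans ?_)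
    exact add_le_add_left (abs_le_max_abs_abs (hv.1 i) (hv.2 i)) _

theorem state_nonneg {Y : Fin k → ℝ → ℝ} {c₀ : ℝ} (hc₀ : 0 ≤ c₀)
    (hsafe : ∀ i c, 0 ≤ c → Y i c ∈ safeAllocations (mean (μ i)) (a i) c) {v : Fin k → ℝ}
    (hv : v ∈ Icc a b) (n : Fin (k + 1)) : 0 ≤ state μ Y c₀ v n := by
  induction n using Fin.induction with
  | zero => rwa [state_zero]
  | succ i ih =>
    rw [state_succ]
    have := hsafe i _ ih
    exact affine_nonneg this.1.1 this.2 (hv.1 i)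

theorem stateMechanism_alloc_adapted (Y : Fin k → ℝ → ℝ) (c₀ : ℝ) (i : Fin k) (v w : Fin k → ℝ)
    (hvw : ∀ j ≤ i, v j = w j) :
    (stateMechanism μ Y c₀).alloc i v = (stateMechanism μ Y c₀).alloc i w ∧
      (stateMechanism μ Y c₀).pay i v = (stateMechanism μ Y c₀).pay i w := by
  have hs : state μ Y c₀ v i.castSucc = state μ Y c₀ w i.castSucc :=
    state_congr Y c₀ _ fun j hj => hvw j (Fin.castSucc_lt_castSucc_iff.1 hj).le
  simp only [stateMechanism, hs, hvw i le_rfl, and_self]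

theorem measurable_stateMechanism_alloc {Y : Fin k → ℝ → ℝ} (hY : ∀ i, Measurable (Y i)) (c₀ : ℝ)
    (i : Fin k) : Measurable ((stateMechanism μ Y c₀).alloc i) :=
  (hY i).comp (measurable_state hY c₀ _)

theorem measurable_stateMechanism_pay {Y : Fin k → ℝ → ℝ} (hY : ∀ i, Measurable (Y i)) (c₀ : ℝ)
    (i : Fin k) : Measurable ((stateMechanism μ Y c₀).pay i) := by
  have h1 := measurable_stateMechanism_alloc (μ := μ) hY c₀ i
  by_cases hi : (i : ℕ) + 1 < k
  · simp only [stateMechanism, hi, if_true]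
    exact (measurable_pi_apply i).mul h1
  · simp only [stateMechanism, hi, if_false]
    exact (h1.mul_const _).sub (measurable_state hY c₀ _)

theorem exists_abs_stateMechanism_pay_le {Y : Fin k → ℝ → ℝ} (hY : ∀ i c, Y i c ∈ Icc (0 : ℝ) 1)
    (c₀ : ℝ) (i : Fin k) : ∃ C, ∀ v ∈ Icc a b, |(stateMechanism μ Y c₀).pay i v| ≤ C := by
  by_cases hi : (i : ℕ) + 1 < k
  · refine ⟨max |a i| |b i|, fun v hv => ?_⟩
    simpa only [stateMechanism, hi, if_true] using abs_mul_le_of_mem hv i (hY i _)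
  · obtain ⟨C, hC⟩ := exists_abs_state_le (μ := μ) (a := a) (b := b) hY c₀ i.castSucc
    refine ⟨|mean (μ i)| + C, fun v hv => ?_⟩
    simp only [stateMechanism, hi, if_false]
    refine (abs_sub _ _).trans (add_le_add ?_ (hC v hv))
    rw [abs_mul, abs_of_nonneg (hY i _).1]
    exact mul_le_of_le_one_left (abs_nonneg _) (hY i _).2

/-- The utility of a buyer of type `t` who reports `v i` at stage `i`, when the utility after the
last stage is `0` and that after any other stage is the state, does not depend on the report. -/
theorem stateMechanism_utility_eq (Y : Fin k → ℝ → ℝ) (c₀ : ℝ) (i : Fin k) (v : Fin k → ℝ) (t : ℝ) :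
    t * (stateMechanism μ Y c₀).alloc i v - (stateMechanism μ Y c₀).pay i v
        + (if i.succ = Fin.last k then 0 else state μ Y c₀ v i.succ)
      = Y i (state μ Y c₀ v i.castSucc) * (t - mean (μ i)) + state μ Y c₀ v i.castSucc := by
  have hlast : i.succ = Fin.last k ↔ ¬ (i : ℕ) + 1 < k := by
    rw [Fin.ext_iff, Fin.val_succ, Fin.val_last]
    omega
  by_cases hi : (i : ℕ) + 1 < k
  · simp only [hlast, hi, stateMechanism, state_succ, if_true, not_true_eq_false, if_false]
    ring
  · simp only [hlast, hi, stateMechanism, if_true, not_false_eq_true, if_false]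
    ring

/-! ### Feasible mechanisms -/

namespace Mechanism

variable {M N : Mechanism k}

/-- The surplus generated at stage `i`. -/
def stageWelfare (M : Mechanism k) (i : Fin k) (v : Fin k → ℝ) : ℝ := v i * M.alloc i v

namespace Feasible

theorem integrable_pay_prepend (hM : M.Feasible μ a b) (n : Fin (k + 1)) {v : Fin k → ℝ}
    (hv : v ∈ Icc a b) (j : Fin k) (hj : n ≤ j.castSucc) :
    Integrable (fun w => M.pay j (prepend n v w)) (Measure.pi μ) := by
  induction n using Fin.cases with
  | zero => simpa only [prepend_zero] using hM.integrable_pay j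
  | succ i =>
    simpa only [splice_eq_prepend] using
      hM.integrable_pay_splice i v hv j (Fin.succ_le_castSucc_iff.1 hj)

theorem stageWelfare_adapted (hM : M.Feasible μ a b) (i : Fin k) (v w : Fin k → ℝ)
    (hvw : ∀ j ≤ i, v j = w j) : M.stageWelfare i v = M.stageWelfare i w := by
  simp only [stageWelfare, (hM.adapted i v w hvw).1, hvw i le_rfl]

theorem stageUtility_adapted (hM : M.Feasible μ a b) (i : Fin k) (v w : Fin k → ℝ)
    (hvw : ∀ j ≤ i, v j = w j) : M.stageUtility i v = M.stageUtility i w := by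
  simp only [stageUtility, (hM.adapted i v w hvw).1, (hM.adapted i v w hvw).2, hvw i le_rfl]

theorem revenue_coinFlip (hM : M.Feasible μ a b) (hN : N.Feasible μ a b) :
    (M.coinFlip N).revenue μ = (1 / 2) * M.revenue μ + (1 / 2) * N.revenue μ := by
  simp only [revenue, Mechanism.coinFlip, Finset.sum_add_distrib, ← Finset.mul_sum]
  rw [integral_add ((integrable_finsetSum _ fun j _ => hM.integrable_pay j).const_mul _)
    ((integrable_finsetSum _ fun j _ => hN.integrable_pay j).const_mul _), integral_const_mul,
    integral_const_mul]

end Feasible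

end Mechanism

variable [∀ i, IsProbabilityMeasure (μ i)]

/-! ### The upper bound on the revenue of feasible mechanisms -/

theorem ae_mem_box (h : ∀ i, IsValueLaw (μ i) (a i) (b i)) :
    ∀ᵐ v ∂(Measure.pi μ), v ∈ Icc a b := by
  have : ∀ᵐ v ∂(Measure.pi μ), ∀ i, v i ∈ Icc (a i) (b i) := ae_all_iff.2 fun i =>
    (measurePreserving_eval μ i).quasiMeasurePreserving.ae (h i).ae_mem
  filter_upwards [this] with v hv
  exact ⟨fun i => (hv i).1, fun i => (hv i).2⟩

theorem integrable_prepend_of_bounded (h : ∀ i, IsValueLaw (μ i) (a i) (b i))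
    {f : (Fin k → ℝ) → ℝ} (hf : Measurable f) {C : ℝ} (hC : ∀ v ∈ Icc a b, |f v| ≤ C)
    (n : Fin (k + 1)) {v : Fin k → ℝ} (hv : v ∈ Icc a b) :
    Integrable (fun w => f (prepend n v w)) (Measure.pi μ) :=
  Integrable.of_bound (hf.comp (measurable_prepend n v)).aestronglyMeasurable C
    ((ae_mem_box h).mono fun _ hw => hC _ (prepend_mem_Icc n hv hw))

namespace Mechanism

variable {M N : Mechanism k}

namespace Feasible

theorem integrable_stageWelfare (hM : M.Feasible μ a b) (h : ∀ i, IsValueLaw (μ i) (a i) (b i))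
    (n : Fin (k + 1)) {v : Fin k → ℝ} (hv : v ∈ Icc a b) (j : Fin k) :
    Integrable (fun w => M.stageWelfare j (prepend n v w)) (Measure.pi μ) :=
  integrable_prepend_of_bounded h ((measurable_pi_apply j).mul (hM.measurable_alloc j))
    (fun _ hw => abs_mul_le_of_mem hw j (hM.alloc_mem j _ hw)) n hv

theorem integrable_stageUtility (hM : M.Feasible μ a b) (h : ∀ i, IsValueLaw (μ i) (a i) (b i))
    (n : Fin (k + 1)) {v : Fin k → ℝ} (hv : v ∈ Icc a b) (j : Fin k) (hj : n ≤ j.castSucc) :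
    Integrable (fun w => M.stageUtility j (prepend n v w)) (Measure.pi μ) :=
  (hM.integrable_stageWelfare h n hv j).sub (hM.integrable_pay_prepend n hv j hj)

theorem rewardToGo_stageUtility_nonneg (hM : M.Feasible μ a b)
    (h : ∀ i, IsValueLaw (μ i) (a i) (b i)) (n : Fin (k + 1)) {v : Fin k → ℝ}
    (hv : v ∈ Icc a b) : 0 ≤ rewardToGo μ M.stageUtility n v :=
  integral_nonneg_of_ae ((ae_mem_box h).mono fun _ hw =>
    Finset.sum_nonneg fun j _ => hM.ir j _ (prepend_mem_Icc n hv hw))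

theorem revenue_eq (hM : M.Feasible μ a b) (h : ∀ i, IsValueLaw (μ i) (a i) (b i))
    {v : Fin k → ℝ} (hv : v ∈ Icc a b) :
    M.revenue μ = rewardToGo μ M.stageWelfare 0 v - rewardToGo μ M.stageUtility 0 v := by
  unfold rewardToGo revenue
  rw [← integral_sub (integrable_finsetSum _ fun j _ => hM.integrable_stageWelfare h 0 hv j)
    (integrable_finsetSum _ fun j _ => hM.integrable_stageUtility h 0 hv j (Fin.zero_le _))]
  simp [stagesFrom_zero, prepend_zero, ← Finset.sum_sub_distrib, stageWelfare, stageUtility]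

/-- After every history, the welfare to go of a feasible mechanism exceeds the tradeoff function at
the utility to go by at most the monopoly revenues of the remaining items. -/
theorem rewardToGo_stageWelfare_le (hM : M.Feasible μ a b)
    (h : ∀ i, IsValueLaw (μ i) (a i) (b i)) {G : Fin (k + 1) → ℝ → ℝ}
    (hG : ∀ n, IsTradeoffShape (G n))
    (hgr : ∀ i c, 0 ≤ c → IsGreatest (realObjective (μ i) (G i.succ) c ''
        safeAllocations (mean (μ i)) (a i) c) (G i.castSucc c))
    {R : Fin k → ℝ} (hR : ∀ i s, s * (μ i).real (Ici s) ≤ R i) (n : Fin (k + 1)) :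
    ∀ v ∈ Icc a b, rewardToGo μ M.stageWelfare n v
      ≤ ∑ j ∈ stagesFrom n, R j + G n (rewardToGo μ M.stageUtility n v) := by
  induction n using Fin.reverseInduction with
  | last =>
    intro v _
    simpa [rewardToGo_last, stagesFrom_last] using (hG _).nonneg 0
  | cast i ih =>
    intro v hv
    obtain ⟨hSint, hS⟩ := rewardToGo_castSucc μ (hM.stageWelfare_adapted i)
      fun j _ => hM.integrable_stageWelfare h i.castSucc hv j
    obtain ⟨hWint, hW⟩ := rewardToGo_castSucc μ (hM.stageUtility_adapted i)
      fun j hj => hM.integrable_stageUtility h i.castSucc hv j hj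
    have hupd : ∀ t ∈ Icc (a i) (b i), Function.update v i t ∈ Icc a b :=
      fun t ht => update_mem_Icc hv ht
    set x : ℝ → ℝ := fun t => M.alloc i (Function.update v i t) with hx
    set W : ℝ → ℝ := fun t => M.stageUtility i (Function.update v i t)
      + rewardToGo μ M.stageUtility i.succ (Function.update v i t) with hWdef
    have hic : ∀ s ∈ Icc (a i) (b i), ∀ t ∈ Icc (a i) (b i), W s + (t - s) * x s ≤ W t := by
      intro s hs t ht
      have := hM.pic i _ (hupd t ht) s hs
      simp only [Function.update_self, Function.update_idem,
        Mechanism.futureUtility_eq_rewardToGo] at this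
      simp only [hWdef, hx, stageUtility, Function.update_self]
      linarith
    have hW0 : ∀ t ∈ Icc (a i) (b i), 0 ≤ W t := fun t ht =>
      add_nonneg (hM.ir i _ (hupd t ht)) (hM.rewardToGo_stageUtility_nonneg h i.succ (hupd t ht))
    have hxm : Measurable x := (hM.measurable_alloc i).comp (measurable_update v)
    have hx01 : ∀ t ∈ Icc (a i) (b i), x t ∈ Icc (0 : ℝ) 1 :=
      fun t ht => hM.alloc_mem i _ (hupd t ht)
    have hxint : Integrable (fun t => t * x t) (μ i) :=
      (h i).integrable_of_bounded (C := max |a i| |b i|) (by fun_prop) fun t ht => by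
        have := abs_mul_le_of_mem (hupd t ht) i (hx01 t ht)
        simpa using this
    obtain ⟨y, hy, hle⟩ := exists_constant_allocation (h i) (hG i.succ) hic hx01 hW0 hxint hWint
      (hR i)
    rw [← hW] at hy hle
    have hc0 : 0 ≤ rewardToGo μ M.stageUtility i.castSucc v :=
      hM.rewardToGo_stageUtility_nonneg h _ hv
    have hle' := (hgr i _ hc0).2 (mem_image_of_mem _ hy)
    have hGW : Integrable (fun t => G i.succ (W t)) (μ i) :=
      (hG i.succ).integrable_comp hWint.aestronglyMeasurable
    have hRG : Integrable (fun t => ∑ j ∈ stagesFrom i.succ, R j + G i.succ (W t)) (μ i) :=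
      (integrable_const _).add hGW
    rw [hS, sum_stagesFrom_castSucc]
    calc _ ≤ ∫ t, (t * x t + (∑ j ∈ stagesFrom i.succ, R j + G i.succ (W t))) ∂(μ i) := by
          refine integral_mono_ae hSint (hxint.add hRG)
            ((h i).ae_mem.mono fun t ht => ?_)
          have h1 := ih _ (hupd t ht)
          -- stage utilities are nonnegative, so the utility after the stage is at most `W t`
          have h2 : rewardToGo μ M.stageUtility i.succ (Function.update v i t) ≤ W t :=
            le_add_of_nonneg_left (hM.ir i _ (hupd t ht))
          have h3 := (hG i.succ).monotone h2
          simp only [stageWelfare, Function.update_self, hx]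
          linarith
      _ = ∫ t, t * x t ∂(μ i) + (∑ j ∈ stagesFrom i.succ, R j + ∫ t, G i.succ (W t) ∂(μ i)) := by
          rw [integral_add hxint hRG, integral_add (integrable_const _) hGW]
          simp
      _ ≤ _ := by linarith

theorem coinFlip (hM : M.Feasible μ a b) (hN : N.Feasible μ a b)
    (h : ∀ i, IsValueLaw (μ i) (a i) (b i)) : (M.coinFlip N).Feasible μ a b := by
  have hstage : ∀ i v, (M.coinFlip N).stageUtility i v
      = (1 / 2) * M.stageUtility i v + (1 / 2) * N.stageUtility i v := fun i v => by
    simp only [stageUtility, Mechanism.coinFlip]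
    ring
  have hfut : ∀ i, ∀ v ∈ Icc a b, (M.coinFlip N).futureUtility μ i v
      = (1 / 2) * M.futureUtility μ i v + (1 / 2) * N.futureUtility μ i v := by
    intro i v hv
    have hsum : ∀ {L : Mechanism k}, L.Feasible μ a b → Integrable
        (fun w => ∑ j ∈ stagesFrom i.succ, L.stageUtility j (prepend i.succ v w))
        (Measure.pi μ) := fun hL => integrable_finsetSum _ fun j hj =>
      hL.integrable_stageUtility h i.succ hv j (mem_stagesFrom.1 hj)
    simp only [Mechanism.futureUtility_eq_rewardToGo, rewardToGo, hstage, Finset.sum_add_distrib,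
      ← Finset.mul_sum]
    rw [integral_add ((hsum hM).const_mul _) ((hsum hN).const_mul _), integral_const_mul,
      integral_const_mul]
  refine ⟨fun i => ?_, fun i => ?_, fun i v w hvw => ?_, fun i v hv => ?_, fun i => ?_,
    fun i v hv j hj => ?_, fun i v hv v' hv' => ?_, fun i v hv => ?_⟩
  · exact ((hM.measurable_alloc i).const_mul _).add ((hN.measurable_alloc i).const_mul _)
  · exact ((hM.measurable_pay i).const_mul _).add ((hN.measurable_pay i).const_mul _)
  · simp only [Mechanism.coinFlip, (hM.adapted i v w hvw).1, (hM.adapted i v w hvw).2,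
      (hN.adapted i v w hvw).1, (hN.adapted i v w hvw).2, and_self]
  · exact convex_Icc (0 : ℝ) 1 (hM.alloc_mem i v hv) (hN.alloc_mem i v hv)
      (one_half_pos (α := ℝ)).le (one_half_pos (α := ℝ)).le (add_halves (1 : ℝ))
  · exact ((hM.integrable_pay i).const_mul _).add ((hN.integrable_pay i).const_mul _)
  · exact ((hM.integrable_pay_splice i v hv j hj).const_mul _).add
      ((hN.integrable_pay_splice i v hv j hj).const_mul _)
  · have h1 := hM.pic i v hv v' hv'
    have h2 := hN.pic i v hv v' hv'
    rw [hfut i v hv, hfut i _ (update_mem_Icc hv hv')]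
    simp only [Mechanism.coinFlip]
    linarith
  · rw [hstage]
    have h1 := hM.ir i v hv
    have h2 := hN.ir i v hv
    linarith

end Feasible

end Mechanism

/-! ### Posted prices -/

theorem feasible_postedPrices (h : ∀ i, IsValueLaw (μ i) (a i) (b i)) (r : Fin k → ℝ) :
    (postedPrices r).Feasible μ a b := by
  have hmeas : ∀ (i : Fin k) (d : ℝ), Measurable fun v : Fin k → ℝ => if r i ≤ v i then d else 0 :=
    fun i d => Measurable.ite (measurableSet_le measurable_const (measurable_pi_apply i))
      measurable_const measurable_const
  have hbd : ∀ (i : Fin k) (v : Fin k → ℝ), |if r i ≤ v i then r i else 0| ≤ |r i| :=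
    fun i v => by split_ifs <;> simp
  have hpay : ∀ (n : Fin (k + 1)) (i : Fin k), ∀ v ∈ Icc a b,
      Integrable (fun w => (postedPrices r).pay i (prepend n v w)) (Measure.pi μ) :=
    fun n i v hv => integrable_prepend_of_bounded h (hmeas i (r i)) (fun w _ => hbd i w) n hv
  have haI : a ∈ Icc a b := ⟨le_rfl, fun i => (h i).le⟩
  refine ⟨fun i => hmeas i 1, fun i => hmeas i (r i), fun i v w hvw => ?_, fun i v hv => ?_,
    fun i => ?_, fun i v hv j hj => ?_, fun i v hv v' hv' => ?_, fun i v hv => ?_⟩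
  · simp only [postedPrices, hvw i le_rfl, and_self]
  · simp only [postedPrices]
    split_ifs <;> simp
  · simpa only [prepend_zero] using hpay 0 i a haI
  · simpa only [splice_eq_prepend] using hpay i.succ j v hv
  · have hfut : (postedPrices r).futureUtility μ i (Function.update v i v')
        = (postedPrices r).futureUtility μ i v := by
      unfold Mechanism.futureUtility
      congr 1
      funext w
      refine Finset.sum_congr rfl fun j hj => ?_
      have hj : ¬ j ≤ i := not_le.2 (Finset.mem_Ioi.1 hj)
      simp [Mechanism.stageUtility, postedPrices, splice, hj]
    rw [hfut]
    simp only [postedPrices, Function.update_self]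
    split_ifs <;> linarith
  · simp only [Mechanism.stageUtility, postedPrices]
    split_ifs <;> linarith

theorem revenue_postedPrices (r : Fin k → ℝ) :
    (postedPrices r).revenue μ = ∑ i, r i * (μ i).real (Ici (r i)) := by
  have hind : ∀ (i : Fin k) (v : Fin k → ℝ), (postedPrices r).pay i v
      = (fun t => r i * (Ici (r i)).indicator 1 t) (Function.eval i v) := fun i v => by
    simp [postedPrices, indicator]
  have hint : ∀ i, Integrable (fun t => r i * (Ici (r i)).indicator (1 : ℝ → ℝ) t) (μ i) :=
    fun i => ((integrable_const (1 : ℝ)).indicator measurableSet_Ici).const_mul _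
  unfold Mechanism.revenue
  rw [integral_finsetSum]
  · refine Finset.sum_congr rfl fun i _ => ?_
    have hmp := measurePreserving_eval μ i
    have hmap := integral_map (f := fun t => r i * (Ici (r i)).indicator (1 : ℝ → ℝ) t)
      hmp.aemeasurable (by rw [hmp.map_eq]; exact (hint i).aestronglyMeasurable)
    simp only [hind]
    rw [← hmap, hmp.map_eq, integral_const_mul, integral_indicator_one measurableSet_Ici]
  · intro i _
    rw [show (postedPrices r).pay i = _ from funext (hind i)]
    exact (measurePreserving_eval μ i).integrable_comp_of_integrable (hint i)

/-! ### Feasibility and welfare of the state-based mechanism -/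

section StateMechanism

variable (h : ∀ i, IsValueLaw (μ i) (a i) (b i)) {Y : Fin k → ℝ → ℝ}
  (hYm : ∀ i, Measurable (Y i)) (hY : ∀ i c, Y i c ∈ Icc (0 : ℝ) 1) (c₀ : ℝ)
include h hYm hY

theorem integrable_stateMechanism_pay (n : Fin (k + 1)) {v : Fin k → ℝ} (hv : v ∈ Icc a b)
    (j : Fin k) :
    Integrable (fun w => (stateMechanism μ Y c₀).pay j (prepend n v w)) (Measure.pi μ) := by
  obtain ⟨C, hC⟩ := exists_abs_stateMechanism_pay_le (μ := μ) (a := a) (b := b) hY c₀ j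
  exact integrable_prepend_of_bounded h (measurable_stateMechanism_pay hYm c₀ j) hC n hv

/-- Before the end, the utility to go of the state-based mechanism is its state. -/
theorem rewardToGo_stageUtility_stateMechanism (n : Fin (k + 1)) :
    ∀ v ∈ Icc a b, rewardToGo μ (stateMechanism μ Y c₀).stageUtility n v
      = if n = Fin.last k then 0 else state μ Y c₀ v n := by
  induction n using Fin.reverseInduction with
  | last =>
    intro v _
    simp [rewardToGo_last]
  | cast i ih =>
    intro v hv
    rw [if_neg i.castSucc_lt_last.ne, (rewardToGo_castSucc μ (fun v w hvw => ?_)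
      fun j _ => ?_).2, integral_congr_ae (g := fun t =>
        Y i (state μ Y c₀ v i.castSucc) * (t - mean (μ i)) + state μ Y c₀ v i.castSucc)
        ((h i).ae_mem.mono fun t ht => ?_), (h i).integral_affine]
    · simp only [ih _ (update_mem_Icc hv ht), Mechanism.stageUtility, Function.update_self,
        stateMechanism_utility_eq, state_update]
    · have := stateMechanism_alloc_adapted (μ := μ) Y c₀ i v w hvw
      simp only [Mechanism.stageUtility, this.1, this.2, hvw i le_rfl]
    · exact (integrable_prepend_of_bounded h
        ((measurable_pi_apply j).mul (measurable_stateMechanism_alloc hYm c₀ j))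
        (fun w hw => abs_mul_le_of_mem hw j (hY j _)) i.castSucc hv).sub
        (integrable_stateMechanism_pay h hYm hY c₀ i.castSucc hv j)

theorem feasible_stateMechanism (hc₀ : 0 ≤ c₀)
    (hsafe : ∀ i c, 0 ≤ c → Y i c ∈ safeAllocations (mean (μ i)) (a i) c) :
    (stateMechanism μ Y c₀).Feasible μ a b := by
  have haI : a ∈ Icc a b := ⟨le_rfl, fun i => (h i).le⟩
  refine ⟨measurable_stateMechanism_alloc hYm c₀, measurable_stateMechanism_pay hYm c₀,
    stateMechanism_alloc_adapted Y c₀, fun i v _ => hY i _, fun i => ?_, fun i v hv j _ => ?_,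
    fun i v hv v' hv' => ?_, fun i v hv => ?_⟩
  · simpa only [prepend_zero] using integrable_stateMechanism_pay h hYm hY c₀ 0 haI i
  · simpa only [splice_eq_prepend] using integrable_stateMechanism_pay h hYm hY c₀ i.succ hv j
  · rw [Mechanism.futureUtility_eq_rewardToGo, Mechanism.futureUtility_eq_rewardToGo,
      rewardToGo_stageUtility_stateMechanism h hYm hY c₀ _ _ hv,
      rewardToGo_stageUtility_stateMechanism h hYm hY c₀ _ _ (update_mem_Icc hv hv'),
      stateMechanism_utility_eq, stateMechanism_utility_eq, state_update]
  · -- the stage utility is the state after the last stage, and `0` before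
    have h1 := stateMechanism_utility_eq (μ := μ) Y c₀ i v (v i)
    rw [← state_succ] at h1
    have h2 := state_nonneg hc₀ hsafe hv i.succ
    unfold Mechanism.stageUtility
    split_ifs at h1 <;> linarith

/-- With optimal allocation probabilities, the welfare to go of the state-based mechanism is the
tradeoff function at the state. -/
theorem rewardToGo_stageWelfare_stateMechanism (hc₀ : 0 ≤ c₀)
    (hsafe : ∀ i c, 0 ≤ c → Y i c ∈ safeAllocations (mean (μ i)) (a i) c)
    {G : Fin (k + 1) → ℝ → ℝ} (hG : ∀ n, IsTradeoffShape (G n))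
    (hlast : ∀ c, 0 ≤ c → G (Fin.last k) c = 0)
    (hopt : ∀ i c, 0 ≤ c → realObjective (μ i) (G i.succ) c (Y i c) = G i.castSucc c)
    (n : Fin (k + 1)) :
    ∀ v ∈ Icc a b, rewardToGo μ (stateMechanism μ Y c₀).stageWelfare n v
      = G n (state μ Y c₀ v n) := by
  have hfeas := feasible_stateMechanism h hYm hY c₀ hc₀ hsafe
  induction n using Fin.reverseInduction with
  | last =>
    intro v hv
    rw [rewardToGo_last, hlast _ (state_nonneg hc₀ hsafe hv _)]
  | cast i ih =>
    intro v hv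
    set c := state μ Y c₀ v i.castSucc with hc
    rw [(rewardToGo_castSucc μ (hfeas.stageWelfare_adapted i)
      fun j _ => hfeas.integrable_stageWelfare h i.castSucc hv j).2,
      integral_congr_ae (g := fun t => t * Y i c + G i.succ (Y i c * (t - mean (μ i)) + c))
        ((h i).ae_mem.mono fun t ht => ?_),
      integral_add ((h i).integrable_id.mul_const _) ((hG i.succ).integrable_affine _ _ _),
      integral_mul_const, ← hopt i c (state_nonneg hc₀ hsafe hv _), realObjective, add_comm,
      mul_comm (Y i c) (mean (μ i))]
    · rfl
    · rw [ih _ (update_mem_Icc hv ht), state_succ, state_update]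
      simp only [Mechanism.stageWelfare, Function.update_self, state_update, stateMechanism, hc]

end StateMechanism

end DynamicSale

theorem theorem3p3 (k : ℕ) (μ : Fin k → MeasureTheory.Measure ℝ)
    [∀ i, MeasureTheory.IsProbabilityMeasure (μ i)] (a b : Fin k → ℝ)
    (ha : ∀ i, 0 ≤ a i)
    (hμ : ∀ i, ∀ᵐ t ∂(μ i), t ∈ Set.Icc (a i) (b i))
    -- `a i` is the smallest possible value of item `i`
    (hlow : ∀ i, ∀ t, a i < t → 0 < μ i (Set.Iio t)) :
    -- the tradeoff functions are concave: their hypographs are convex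
    (∀ i, Convex ℝ {q : ℝ × ℝ | (q.2 : EReal) ≤ DynamicSale.tradeoff μ i q.1}) ∧
    -- the objects that describe the two mechanisms exist
    (∃ r : Fin k → ℝ, ∀ i, DynamicSale.IsMonopolyPrice (μ i) (r i)) ∧
    (∃ Y : Fin k → ℝ → ℝ, (∀ i, Measurable (Y i)) ∧ DynamicSale.IsOptimalAllocation μ Y) ∧
    (∃ c₀ : ℝ, DynamicSale.IsOptimalInitialState μ c₀) ∧
    -- for every choice of them the two mechanisms have the claimed properties
    ∀ (r : Fin k → ℝ) (Y : Fin k → ℝ → ℝ) (c₀ : ℝ),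
      (∀ i, DynamicSale.IsMonopolyPrice (μ i) (r i)) →
      (∀ i, Measurable (Y i)) → DynamicSale.IsOptimalAllocation μ Y →
      DynamicSale.IsOptimalInitialState μ c₀ →
      (DynamicSale.postedPrices r).Feasible μ a b ∧
      (DynamicSale.stateMechanism μ Y c₀).Feasible μ a b ∧
      ((DynamicSale.postedPrices r).coinFlip (DynamicSale.stateMechanism μ Y c₀)).Feasible μ a b ∧
      ((DynamicSale.postedPrices r).coinFlip (DynamicSale.stateMechanism μ Y c₀)).revenue μ
        = (1 / 2) * (DynamicSale.postedPrices r).revenue μ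
          + (1 / 2) * (DynamicSale.stateMechanism μ Y c₀).revenue μ ∧
      ∀ M : DynamicSale.Mechanism k, M.Feasible μ a b →
        (1 / 2) * M.revenue μ ≤
          ((DynamicSale.postedPrices r).coinFlip (DynamicSale.stateMechanism μ Y c₀)).revenue μ := by
  have h : ∀ i, DynamicSale.IsValueLaw (μ i) (a i) (b i) := fun i => ⟨ha i, hμ i, hlow i⟩
  have haI : a ∈ Icc a b := ⟨le_rfl, fun i => (h i).le⟩
  obtain ⟨G, hG, htr, hlast, hgr⟩ := DynamicSale.exists_real_tradeoff h
  refine ⟨fun i => ?_, ?_, ?_, ?_, fun r Y c₀ hr hYm hY hc₀ => ?_⟩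
  · simpa only [htr] using DynamicSale.convex_hypograph_extendBot (hG i)
  · choose r hr using fun i => DynamicSale.IsMonopolyPrice.exists (h i)
    exact ⟨r, hr⟩
  · choose Y hYm hY using fun i : Fin k =>
      DynamicSale.exists_measurable_optimal_allocation (h i) (hG i.succ)
    exact ⟨Y, hYm, fun i c => by simpa only [htr] using hY i c⟩
  · simpa only [DynamicSale.IsOptimalInitialState, htr] using
      DynamicSale.exists_isMax_sub_self (hG 0)
  simp only [DynamicSale.IsOptimalInitialState, DynamicSale.IsOptimalAllocation, htr] at hY hc₀
  obtain ⟨hc₀nn, hc₀max⟩ := DynamicSale.nonneg_of_isMax_sub_self hc₀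
  have hsafe := fun i c (hc : 0 ≤ c) =>
    DynamicSale.mem_safeAllocations_of_isMax (h i) (hG i.succ) hc (hY i c).1 (hY i c).2
  have hopt : ∀ i c, 0 ≤ c →
      DynamicSale.realObjective (μ i) (G i.succ) c (Y i c) = G i.castSucc c := fun i c hc =>
    IsGreatest.unique ⟨mem_image_of_mem _ (hsafe i c hc).1, by
      rintro _ ⟨y, hy, rfl⟩
      exact (hsafe i c hc).2 y hy⟩ (hgr i c hc)
  have hP := DynamicSale.feasible_postedPrices h r
  have hS := DynamicSale.feasible_stateMechanism h hYm (fun i c => (hY i c).1) c₀ hc₀nn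
    fun i c hc => (hsafe i c hc).1
  refine ⟨hP, hS, hP.coinFlip hS h, hP.revenue_coinFlip hS, fun M hM => ?_⟩
  have hU : DynamicSale.rewardToGo μ (DynamicSale.stateMechanism μ Y c₀).stageUtility 0 a ≤ c₀ := by
    rw [DynamicSale.rewardToGo_stageUtility_stateMechanism h hYm (fun i c => (hY i c).1) c₀ 0 a haI]
    -- without items the utility is `0`, otherwise it is the initial state
    split_ifs
    · exact hc₀nn
    · rw [DynamicSale.state_zero]
  have hW := DynamicSale.rewardToGo_stageWelfare_stateMechanism h hYm (fun i c => (hY i c).1) c₀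
    hc₀nn (fun i c hc => (hsafe i c hc).1) hG hlast hopt 0 a haI
  rw [DynamicSale.state_zero] at hW
  have hrevS := hS.revenue_eq h haI
  have hrevM := hM.revenue_eq h haI
  have hMle := hM.rewardToGo_stageWelfare_le h hG hgr hr 0 a haI
  have hMmax := hc₀max _ (hM.rewardToGo_stageUtility_nonneg h 0 haI)
  rw [DynamicSale.stagesFrom_zero] at hMle
  rw [hP.revenue_coinFlip hS, DynamicSale.revenue_postedPrices]
  linarith
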